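/- Let $k$ be a field and let $\mathcal{T}$ be a $k$-linear triangulated category with suspension $\Sigma$ which has finite-dimensional morphism spaces and split idempotents. Suppose that $\mathcal{T}$ is $2$-Calabi--Yau, that is, $\mathcal{T}$ has a Serre functor $\mathbb{S}$ (a self-equivalence with natural $k$-linear isomorphisms $\mathcal{T}(X,\mathbb{S}Y)\cong \operatorname{Hom}_k(\mathcal{T}(Y,X),k)$) and $\mathbb{S}\cong\Sigma^2$; it is enough that $\mathbb{S}$ and $\Sigma^2$ are isomorphic as functors, compatibility with the triangulated structures is not required. Let $T\in\mathcal{T}$ be a $2$-cluster tilting object: the category $\operatorname{add}T$ of direct summands of finite direct sums of copies of $T$ is functorially finite in $\mathcal{T}$ and $$\operatorname{add}T=\{X\in\mathcal{T}\mid \mathcal{T}(\operatorname{add}T,\Sigma X)=0\}=\{X\in\mathcal{T}\mid\mathcal{T}(X,\Sigma\operatorname{add}T)=0\}.$$ Let $\Lambda$ be a $k$-algebra isomorphic to $\operatorname{End}_{\mathcal{T}}(T)$ (a $2$-Calabi--Yau tilted algebra), and suppose that $\Lambda$ is selfinjective, i.e. injective as a right module over itself. Then the Nakayama functor $\nu=\operatorname{Hom}_k(\operatorname{Hom}_\Lambda(-,\Lambda),k)$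 restricts to a self-equivalence of the category $\operatorname{proj}\Lambda$ of finitely generated projective right $\Lambda$-modules, and $\operatorname{proj}\Lambda$ is a $4$-angulated category with suspension $\nu$. The latter means that there is a class of sequences $X_1\xrightarrow{\alpha_1}X_2\xrightarrow{\alpha_2}X_3\xrightarrow{\alpha_3}X_4\xrightarrow{\alpha_4}\nu X_1$ in $\operatorname{proj}\Lambda$, called $4$-angles, such that: 1. (F1) the class is closed under (isomorphisms,) direct sums and direct summands, contains $X\xrightarrow{1}X\to0\to0\to\nu X$ for every $X$, and every morphism $\alpha_1$ is the first morphism of some $4$-angle; 2. (F2) a sequence as above is a $4$-angle if and only if its left rotation $X_2\xrightarrow{\alpha_2}X_3\xrightarrow{\alpha_3}X_4\xrightarrow{\alpha_4}\nu X_1\xrightarrow{\nu\alpha_1}\nu X_2$ is one; 3. (F3) for $4$-angles $X_\bullet$, $Y_\bullet$ with morphisms $\alpha_i$, $\beta_i$, every pair $\varphi_1\colon X_1\to Y_1$, $\varphi_2\colon X_2\to Y_2$ with $\varphi_2\alpha_1=\beta_1\varphi_1$ can be completed to a morphism $\varphi_\bullet=(\varphi_1,\varphi_2,\varphi_3,\varphi_4)\colon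 X_\bullet\to Y_\bullet$ of sequences, that is, $\varphi_{i+1}\alpha_i=\beta_i\varphi_i$ for $i=1,2,3$ and $(\nu\varphi_1)\alpha_4=\beta_4\varphi_4$; 4. (F4) in (F3), $\varphi_3$ and $\varphi_4$ can be chosen such that the cone $$X_2\oplus Y_1\to X_3\oplus Y_2\to X_4\oplus Y_3\to \nu X_1\oplus Y_4\to\nu X_2\oplus\nu Y_1$$ with morphisms $$\begin{pmatrix}-\alpha_2&0\\ \varphi_2&\beta_1\end{pmatrix},\quad \begin{pmatrix}-\alpha_3&0\\ \varphi_3&\beta_2\end{pmatrix},\quad \begin{pmatrix}-\alpha_4&0\\ \varphi_4&\beta_3\end{pmatrix},\quad \begin{pmatrix}-\nu\alpha_1&0\\ \nu\varphi_1&\beta_4\end{pmatrix}$$ is a $4$-angle. -/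

import Mathlib

open CategoryTheory CategoryTheory.Limits MulOpposite

universe u v w

/-! ### Four-angulated categories -/

section FourAngulated

variable {F : Type w} [Category.{v} F]

/-- A `4`-`S`-sequence `X₁ ⟶ X₂ ⟶ X₃ ⟶ X₄ ⟶ S X₁` in a category `F` with an endofunctor `S`. -/
structure FourSeq (S : F ⥤ F) where
  {X₁ X₂ X₃ X₄ : F}
  α₁ : X₁ ⟶ X₂
  α₂ : X₂ ⟶ X₃
  α₃ : X₃ ⟶ X₄
  α₄ : X₄ ⟶ S.obj X₁

namespace FourSeq

variable {S : F ⥤ F}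

/-- A morphism of `4`-`S`-sequences. -/
structure Hom (X Y : FourSeq S) where
  φ₁ : X.X₁ ⟶ Y.X₁
  φ₂ : X.X₂ ⟶ Y.X₂
  φ₃ : X.X₃ ⟶ Y.X₃
  φ₄ : X.X₄ ⟶ Y.X₄
  comm₁ : X.α₁ ≫ φ₂ = φ₁ ≫ Y.α₁
  comm₂ : X.α₂ ≫ φ₃ = φ₂ ≫ Y.α₂
  comm₃ : X.α₃ ≫ φ₄ = φ₃ ≫ Y.α₃
  comm₄ : X.α₄ ≫ S.map φ₁ = φ₄ ≫ Y.α₄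

/-- Two `4`-`S`-sequences are isomorphic if there is a morphism between them all of whose
components are isomorphisms. -/
def Isomorphic (X Y : FourSeq S) : Prop :=
  ∃ φ : Hom X Y, IsIso φ.φ₁ ∧ IsIso φ.φ₂ ∧ IsIso φ.φ₃ ∧ IsIso φ.φ₄

/-- The left rotation `X₂ ⟶ X₃ ⟶ X₄ ⟶ S X₁ ⟶ S X₂`; the sign `(-1) ^ 4` of the last
morphism `S α₁` is `1`. -/
def rotate (X : FourSeq S) : FourSeq S where
  α₁ := X.α₂
  α₂ := X.α₃
  α₃ := X.α₄
  α₄ := S.map X.α₁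

variable [Preadditive F]

open ZeroObject in
/-- The trivial sequence `X ⟶ X ⟶ 0 ⟶ 0 ⟶ S X` whose first morphism is the identity. -/
noncomputable def trivial [HasZeroObject F] (S : F ⥤ F) (X : F) : FourSeq S where
  X₁ := X
  X₂ := X
  X₃ := 0
  X₄ := 0
  α₁ := 𝟙 X
  α₂ := 0
  α₃ := 0
  α₄ := 0

variable [HasBinaryBiproducts F]

/-- The direct sum of two `4`-`S`-sequences. The last morphism is the diagonal morphism
`X₄ ⊞ Y₄ ⟶ S X₁ ⊞ S Y₁` followed by the canonical morphism to `S (X₁ ⊞ Y₁)`. -/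
noncomputable def directSum (X Y : FourSeq S) : FourSeq S where
  X₁ := X.X₁ ⊞ Y.X₁
  X₂ := X.X₂ ⊞ Y.X₂
  X₃ := X.X₃ ⊞ Y.X₃
  X₄ := X.X₄ ⊞ Y.X₄
  α₁ := biprod.map X.α₁ Y.α₁
  α₂ := biprod.map X.α₂ Y.α₂
  α₃ := biprod.map X.α₃ Y.α₃
  α₄ := biprod.desc (X.α₄ ≫ S.map biprod.inl) (Y.α₄ ≫ S.map biprod.inr)

/-- The cone of a morphism of `4`-`S`-sequences:
`X₂ ⊞ Y₁ ⟶ X₃ ⊞ Y₂ ⟶ X₄ ⊞ Y₃ ⟶ S X₁ ⊞ Y₄ ⟶ S (X₂ ⊞ Y₁)`, the morphisms being given by the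
matrices `(-α₂, 0; φ₂, β₁)`, `(-α₃, 0; φ₃, β₂)`, `(-α₄, 0; φ₄, β₃)` and
`(-S α₁, 0; S φ₁, β₄)`. -/
noncomputable def cone {X Y : FourSeq S} (φ : Hom X Y) : FourSeq S where
  X₁ := X.X₂ ⊞ Y.X₁
  X₂ := X.X₃ ⊞ Y.X₂
  X₃ := X.X₄ ⊞ Y.X₃
  X₄ := S.obj X.X₁ ⊞ Y.X₄
  α₁ := biprod.desc (biprod.lift (-X.α₂) φ.φ₂) (biprod.lift 0 Y.α₁)
  α₂ := biprod.desc (biprod.lift (-X.α₃) φ.φ₃) (biprod.lift 0 Y.α₂)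
  α₃ := biprod.desc (biprod.lift (-X.α₄) φ.φ₄) (biprod.lift 0 Y.α₃)
  α₄ := biprod.desc (-S.map X.α₁ ≫ S.map biprod.inl + S.map φ.φ₁ ≫ S.map biprod.inr)
    (Y.α₄ ≫ S.map biprod.inr)

end FourSeq

/-- A class `A` of `4`-`S`-sequences (the `4`-angles) is a `4`-angulation of `(F, S)`, where `F`
is an additive category and `S` a self-equivalence of `F`. -/
structure IsFourAngulation [Preadditive F] [HasZeroObject F] [HasBinaryBiproducts F]
    (S : F ⥤ F) [S.IsEquivalence] (A : Set (FourSeq S)) : Prop where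
  /-- Closure under direct sums (and isomorphisms). -/
  directSum_mem : ∀ X Y Z : FourSeq S, (X.directSum Y).Isomorphic Z → X ∈ A → Y ∈ A → Z ∈ A
  /-- Closure under direct summands. -/
  summand_mem : ∀ X Y Z : FourSeq S, (X.directSum Y).Isomorphic Z → Z ∈ A → X ∈ A
  trivial_mem : ∀ X : F, FourSeq.trivial S X ∈ A
  /-- Each morphism is the first morphism of a `4`-angle. -/
  exists_mem : ∀ {X₁ X₂ : F} (α₁ : X₁ ⟶ X₂), ∃ (X₃ X₄ : F) (α₂ : X₂ ⟶ X₃) (α₃ : X₃ ⟶ X₄)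
    (α₄ : X₄ ⟶ S.obj X₁), FourSeq.mk α₁ α₂ α₃ α₄ ∈ A
  rotate_mem_iff : ∀ X : FourSeq S, X.rotate ∈ A ↔ X ∈ A
  /-- Each commutative square on the first morphisms extends to a morphism of `4`-angles. -/
  exists_hom : ∀ X ∈ A, ∀ Y ∈ A, ∀ (φ₁ : X.X₁ ⟶ Y.X₁) (φ₂ : X.X₂ ⟶ Y.X₂),
    X.α₁ ≫ φ₂ = φ₁ ≫ Y.α₁ → ∃ φ : FourSeq.Hom X Y, φ.φ₁ = φ₁ ∧ φ.φ₂ = φ₂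
  /-- The extension can be chosen such that its cone is a `4`-angle. -/
  exists_hom_cone_mem : ∀ X ∈ A, ∀ Y ∈ A, ∀ (φ₁ : X.X₁ ⟶ Y.X₁) (φ₂ : X.X₂ ⟶ Y.X₂),
    X.α₁ ≫ φ₂ = φ₁ ≫ Y.α₁ →
      ∃ φ : FourSeq.Hom X Y, φ.φ₁ = φ₁ ∧ φ.φ₂ = φ₂ ∧ FourSeq.cone φ ∈ A

end FourAngulated

/-! ### Serre functors and the Calabi-Yau condition -/

section Serre

variable (k : Type u) [Field k] {C : Type w} [Category.{v} C] [Preadditive C] [Linear k C]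

/-- Serre duality for an endofunctor `S` of a `k`-linear category: `k`-linear isomorphisms
`Hom(X, S Y) ≅ D Hom(Y, X)`, natural in `X` and `Y`, with `D` the `k`-dual. -/
structure SerreDuality (S : C ⥤ C) where
  equiv (X Y : C) : (X ⟶ S.obj Y) ≃ₗ[k] Module.Dual k (Y ⟶ X)
  naturality {X X' Y Y' : C} (f : X' ⟶ X) (g : Y ⟶ Y') (h : X ⟶ S.obj Y) (t : Y' ⟶ X') :
    equiv X' Y' (f ≫ h ≫ S.map g) t = equiv X Y h (g ≫ t ≫ f)

/-- A Serre functor of a `k`-linear category is a self-equivalence with Serre duality. -/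
def IsSerreFunctor (S : C ⥤ C) : Prop :=
  S.IsEquivalence ∧ Nonempty (SerreDuality k S)

variable (C) in
/-- A `k`-linear triangulated category is weakly `d`-Calabi-Yau if it has a Serre functor which
is isomorphic to the `d`-th power of the suspension. The isomorphism is not required to be
compatible with the structures of triangle functors, so a category which is `d`-Calabi-Yau in
the stronger sense of an isomorphism of triangle functors is in particular weakly
`d`-Calabi-Yau. -/
def IsWeaklyCalabiYau [HasShift C ℤ] (d : ℤ) : Prop :=
  ∃ S : C ⥤ C, IsSerreFunctor k S ∧ Nonempty (S ≅ shiftFunctor C d)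

end Serre

/-! ### Cluster tilting -/

section ClusterTilting

variable {C : Type w} [Category.{v} C]

/-- Every object has a right approximation and a left approximation by objects in `P`. -/
def IsFunctoriallyFinite (P : ObjectProperty C) : Prop :=
  (∀ X : C, ∃ (M : C) (p : M ⟶ X), P M ∧ ∀ (N : C) (f : N ⟶ X), P N → ∃ g : N ⟶ M, g ≫ p = f) ∧
  (∀ X : C, ∃ (M : C) (i : X ⟶ M), P M ∧ ∀ (N : C) (f : X ⟶ N), P N → ∃ g : M ⟶ N, i ≫ g = f)

/-- `d`-cluster tilting (full) subcategories of a triangulated category. -/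
structure IsClusterTilting [Preadditive C] [HasShift C ℤ] (d : ℕ) (P : ObjectProperty C) :
    Prop where
  functoriallyFinite : IsFunctoriallyFinite P
  mem_iff_right : ∀ X : C, P X ↔ ∀ i : ℕ, 1 ≤ i → i < d → ∀ M : C, P M →
    ∀ f : M ⟶ X⟦(i : ℤ)⟧, f = 0
  mem_iff_left : ∀ X : C, P X ↔ ∀ i : ℕ, 1 ≤ i → i < d → ∀ M : C, P M →
    ∀ f : X ⟶ M⟦(i : ℤ)⟧, f = 0

/-- `add T`: the direct summands of finite direct sums of copies of `T`. -/
def addProperty [Preadditive C] [HasBinaryBiproducts C] [HasFiniteBiproducts C] (T : C) : ObjectProperty C :=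
  fun X => ∃ (n : ℕ) (Y : C), Nonempty (X ⊞ Y ≅ ⨁ fun _ : Fin n => T)

end ClusterTilting

/-! ### Finitely generated projective right modules and the Nakayama functor -/

section Modules

variable (k : Type u) [Field k] (Λ : Type u) [Ring Λ] [Algebra k Λ]

/-- A ring is selfinjective if it is injective as a right module over itself. -/
def IsSelfinjective (Λ : Type u) [Ring Λ] : Prop :=
  Module.Injective Λᵐᵒᵖ Λ

/-- The finitely generated projective right `Λ`-modules. -/
def fgProjective (Λ : Type u) [Ring Λ] : ObjectProperty (ModuleCat.{u} Λᵐᵒᵖ) :=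
  fun P => Module.Finite Λᵐᵒᵖ P ∧ Module.Projective Λᵐᵒᵖ P

/-- The category `proj Λ` of finitely generated projective right `Λ`-modules. -/
abbrev FGProj (Λ : Type u) [Ring Λ] : Type (u + 1) := (fgProjective Λ).FullSubcategory

/-- The `k`-dual `D Hom_Λ(M, Λ)` for a right `Λ`-module `M`. -/
def NakayamaModule (M : Type u) [AddCommGroup M] [Module Λᵐᵒᵖ M] : Type u :=
  Module.Dual k (M →ₗ[Λᵐᵒᵖ] Λ)

namespace NakayamaModule

variable (M : Type u) [AddCommGroup M] [Module Λᵐᵒᵖ M]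

instance : AddCommGroup (NakayamaModule k Λ M) :=
  inferInstanceAs (AddCommGroup (Module.Dual k (M →ₗ[Λᵐᵒᵖ] Λ)))

/-- The left `Λ`-module structure `(a • f) m = a * f m` on `Hom_Λ(M, Λ)` induces the right
`Λ`-module structure `(φ • a) f = φ (a • f)` on the dual. -/
instance : Module Λᵐᵒᵖ (NakayamaModule k Λ M) where
  smul a φ := (show Module.Dual k (M →ₗ[Λᵐᵒᵖ] Λ) from φ) ∘ₗ
    { toFun := fun f => a.unop • f
      map_add' := fun f g => smul_add _ f g
      map_smul' := fun c f => smul_comm _ c f }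
  one_smul φ := by
    refine LinearMap.ext fun f => ?_
    exact congrArg (DFunLike.coe (F := Module.Dual k (M →ₗ[Λᵐᵒᵖ] Λ)) φ) (one_smul Λ f)
  mul_smul a b φ := by
    refine LinearMap.ext fun f => ?_
    exact congrArg (DFunLike.coe (F := Module.Dual k (M →ₗ[Λᵐᵒᵖ] Λ)) φ) (mul_smul b.unop a.unop f)
  smul_zero a := rfl
  smul_add a φ ψ := rfl
  add_smul a b φ := by
    refine LinearMap.ext fun f => ?_
    exact (congrArg (DFunLike.coe (F := Module.Dual k (M →ₗ[Λᵐᵒᵖ] Λ)) φ)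
      (add_smul a.unop b.unop f)).trans (map_add (M := M →ₗ[Λᵐᵒᵖ] Λ) (N := k) _ _ _)
  zero_smul φ := by
    refine LinearMap.ext fun f => ?_
    exact (congrArg (DFunLike.coe (F := Module.Dual k (M →ₗ[Λᵐᵒᵖ] Λ)) φ)
      (zero_smul Λ f)).trans (map_zero (M := M →ₗ[Λᵐᵒᵖ] Λ) (N := k) _)

end NakayamaModule

/-- The Nakayama functor `ν = D Hom_Λ(-, Λ)` on right `Λ`-modules; for `g : M ⟶ N` it sends a
functional `φ` on `Hom_Λ(M, Λ)` to the functional `f ↦ φ (f ∘ g)` on `Hom_Λ(N, Λ)`. -/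
noncomputable def nakayama : ModuleCat.{u} Λᵐᵒᵖ ⥤ ModuleCat.{u} Λᵐᵒᵖ where
  obj M := ModuleCat.of Λᵐᵒᵖ (NakayamaModule k Λ M)
  map {M N} g := ModuleCat.ofHom
    { toFun := fun φ => (show Module.Dual k (M →ₗ[Λᵐᵒᵖ] Λ) from φ) ∘ₗ
        ({ toFun := fun f => f ∘ₗ g.hom
           map_add' := fun _ _ => rfl
           map_smul' := fun _ _ => rfl } : (N →ₗ[Λᵐᵒᵖ] Λ) →ₗ[k] (M →ₗ[Λᵐᵒᵖ] Λ))
      map_add' := fun _ _ => rfl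
      map_smul' := fun _ _ => rfl }
  map_id _ := rfl
  map_comp _ _ := rfl

/-- The functor `proj Λ ⥤ proj Λ` induced by the Nakayama functor, provided that the latter
preserves finitely generated projective modules. -/
noncomputable def nakayamaProj
    (h : ∀ P : FGProj Λ, fgProjective Λ ((nakayama k Λ).obj P.obj)) : FGProj Λ ⥤ FGProj Λ :=
  (fgProjective Λ).lift ((fgProjective Λ).ι ⋙ nakayama k Λ) h

instance : (fgProjective Λ).ContainsZero where
  exists_zero := ⟨ModuleCat.of Λᵐᵒᵖ PUnit, ModuleCat.isZero_of_subsingleton _,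
    inferInstanceAs (Module.Finite Λᵐᵒᵖ PUnit.{u + 1}),
    inferInstanceAs (Module.Projective Λᵐᵒᵖ PUnit.{u + 1})⟩

instance : (fgProjective Λ).IsClosedUnderIsomorphisms where
  of_iso i h :=
    have := h.1
    have := h.2
    ⟨Module.Finite.equiv i.toLinearEquiv, Module.Projective.of_equiv i.toLinearEquiv⟩

instance : (fgProjective Λ).IsClosedUnderBinaryProducts where
  limitsOfShape_le := by
    rintro X ⟨p⟩
    let M := p.diag.obj ⟨WalkingPair.left⟩
    let N := p.diag.obj ⟨WalkingPair.right⟩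
    have hM : fgProjective Λ M := p.prop_diag_obj ⟨WalkingPair.left⟩
    have hN : fgProjective Λ N := p.prop_diag_obj ⟨WalkingPair.right⟩
    have : Module.Finite Λᵐᵒᵖ M := hM.1
    have : Module.Projective Λᵐᵒᵖ M := hM.2
    have : Module.Finite Λᵐᵒᵖ N := hN.1
    have : Module.Projective Λᵐᵒᵖ N := hN.2
    let e : X ≃ₗ[Λᵐᵒᵖ] (M × N) := (IsLimit.conePointsIsoOfNatIso p.isLimit
      (ModuleCat.binaryProductLimitCone M N).isLimit (diagramIsoPair p.diag)).toLinearEquiv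
    exact ⟨Module.Finite.equiv e.symm, Module.Projective.of_equiv e.symm⟩

instance : (fgProjective Λ).IsClosedUnderFiniteProducts := .mk'

instance : HasBinaryBiproducts (FGProj Λ) := HasBinaryBiproducts.of_hasBinaryProducts

end Modules

/-! The functor Hom(T, -) identifies add T with proj Λ. For X in add T, Serre duality gives Hom(T,
𝕊X) ≅ D Hom(X, T) ≅ ν Hom(T, X), so under this identification ν becomes 𝕊 ≅ Σ². It remains to see
that add T is stable under Σ², and that a 2-cluster tilting subcategory stable under Σ² is
4-angulated with suspension Σ².

Stability is where selfinjectivity enters. Generators of Hom(T, 𝕊T) over k define j : T ⟶ (𝕊T)ⁿ, and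
Hom(T, j) is injective because Serre duality is nondegenerate. As Λ is injective, Hom(T, j) has a
Λ-linear retraction. As Hom(T, -) is full on all of `C` (`IsClusterTilting.map_surjective`), this
retraction is induced by a morphism, so T is a retract of (Σ²T)ⁿ (`exists_retractData_serre`).
Therefore Hom(Σ²T, ΣT) embeds into Hom(Σ²T, Σ³T)ⁿ ≅ Hom(T, ΣT)ⁿ = 0, which means that Σ²T lies in
add T.

The 4-angles are the sequences in add T that are spliced from two distinguished triangles
(`IsQuad`); the splicing object need not lie in add T. Rotation is the octahedral axiom. A morphism
is completed to a 4-angle by a left approximation of its cone. Good completions of commutative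
squares come from an octahedron followed by a homotopy cartesian square (`IsQuad.exists_cone`).
Closure under direct summands is not formal: it uses Hom(X, ΣY) = 0 and Hom(ΣX, Y) = 0 for X, Y in
add T to make the splicing morphisms diagonal, and the second vanishing follows from stability under
Σ². -/

/-! ### Distinguished triangles given by their morphisms -/

section Triangles

open Pretriangulated

variable {C : Type w} [Category.{v} C] [Preadditive C] [HasZeroObject C] [HasShift C ℤ]
  [∀ n : ℤ, (shiftFunctor C n).Additive] [Pretriangulated C]

/-- The triangle with the given morphisms is distinguished. -/
def IsDist {X Y Z : C} (f : X ⟶ Y) (g : Y ⟶ Z) (h : Z ⟶ X⟦(1 : ℤ)⟧) : Prop :=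
  Triangle.mk f g h ∈ distTriang C

namespace IsDist

variable {X Y Z X' Y' Z' : C} {f : X ⟶ Y} {g : Y ⟶ Z} {h : Z ⟶ X⟦(1 : ℤ)⟧}
  {f' : X' ⟶ Y'} {g' : Y' ⟶ Z'} {h' : Z' ⟶ X'⟦(1 : ℤ)⟧}

lemma of_iso (H : IsDist f g h) (e₁ : X ≅ X') (e₂ : Y ≅ Y') (e₃ : Z ≅ Z')
    (c₁ : f ≫ e₂.hom = e₁.hom ≫ f') (c₂ : g ≫ e₃.hom = e₂.hom ≫ g')
    (c₃ : h ≫ e₁.hom⟦(1 : ℤ)⟧' = e₃.hom ≫ h') : IsDist f' g' h' :=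
  isomorphic_distinguished _ H _ (Triangle.isoMk _ _ e₁ e₂ e₃ c₁ c₂ c₃).symm

lemma rotate (H : IsDist f g h) : IsDist g h (-f⟦(1 : ℤ)⟧') :=
  rot_of_distTriang _ H

lemma of_rotate (H : IsDist g h (-f⟦(1 : ℤ)⟧')) : IsDist f g h :=
  (rotate_distinguished_triangle (Triangle.mk f g h)).2 H

lemma zero₁₂ (H : IsDist f g h) : f ≫ g = 0 := comp_distTriang_mor_zero₁₂ _ H
lemma zero₂₃ (H : IsDist f g h) : g ≫ h = 0 := comp_distTriang_mor_zero₂₃ _ H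
lemma zero₃₁ (H : IsDist f g h) : h ≫ f⟦(1 : ℤ)⟧' = 0 := comp_distTriang_mor_zero₃₁ _ H

lemma exists_desc₂ (H : IsDist f g h) {W : C} (t : Y ⟶ W) (ht : f ≫ t = 0) :
    ∃ s : Z ⟶ W, g ≫ s = t := by
  obtain ⟨s, hs⟩ := Triangle.yoneda_exact₂ _ H t ht
  exact ⟨s, hs.symm⟩

lemma exists_desc₃ (H : IsDist f g h) {W : C} (t : Z ⟶ W) (ht : g ≫ t = 0) :
    ∃ s : X⟦(1 : ℤ)⟧ ⟶ W, h ≫ s = t := by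
  obtain ⟨s, hs⟩ := Triangle.yoneda_exact₃ _ H t ht
  exact ⟨s, hs.symm⟩

lemma exists_lift₁ (H : IsDist f g h) {W : C} (t : W ⟶ X⟦(1 : ℤ)⟧) (ht : t ≫ f⟦(1 : ℤ)⟧' = 0) :
    ∃ s : W ⟶ Z, s ≫ h = t := by
  obtain ⟨s, hs⟩ := Triangle.coyoneda_exact₁ _ H t ht
  exact ⟨s, hs.symm⟩

lemma exists_hom₃ (H : IsDist f g h) (H' : IsDist f' g' h') (a : X ⟶ X') (b : Y ⟶ Y')
    (comm : f ≫ b = a ≫ f') : ∃ c : Z ⟶ Z', g ≫ c = b ≫ g' ∧ h ≫ a⟦(1 : ℤ)⟧' = c ≫ h' :=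
  complete_distinguished_triangle_morphism _ _ H H' a b comm

lemma exists_iso₃ (H : IsDist f g h) (H' : IsDist f' g' h') (a : X ≅ X') (b : Y ≅ Y')
    (comm : f ≫ b.hom = a.hom ≫ f') :
    ∃ c : Z ≅ Z', g ≫ c.hom = b.hom ≫ g' ∧ h ≫ a.hom⟦(1 : ℤ)⟧' = c.hom ≫ h' := by
  let e := isoTriangleOfIso₁₂ _ _ H H' a b comm
  have h₂ := e.hom.comm₂
  have h₃ := e.hom.comm₃
  exact ⟨Triangle.π₃.mapIso e, h₂, h₃⟩

lemma isIso₃ (H : IsDist f g h) (H' : IsDist f' g' h') (a : X ⟶ X') (b : Y ⟶ Y') (c : Z ⟶ Z')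
    [IsIso a] [IsIso b] (c₁ : f ≫ b = a ≫ f') (c₂ : g ≫ c = b ≫ g')
    (c₃ : h ≫ a⟦(1 : ℤ)⟧' = c ≫ h') : IsIso c :=
  isIso₃_of_isIso₁₂ (Triangle.homMk (Triangle.mk f g h) (Triangle.mk f' g' h') a b c c₁ c₂ c₃)
    H H' (by assumption) (by assumption)

lemma neg₁₂ (H : IsDist f g h) : IsDist (-f) (-g) h :=
  H.of_iso (Iso.refl _) (⟨-𝟙 _, -𝟙 _, by simp, by simp⟩) (Iso.refl _) (by simp) (by simp) (by simp)

lemma neg₂₃ (H : IsDist f g h) : IsDist f (-g) (-h) :=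
  H.of_iso (Iso.refl _) (Iso.refl _) (⟨-𝟙 _, -𝟙 _, by simp, by simp⟩) (by simp) (by simp) (by simp)

end IsDist

lemma exists_isDist {X Y : C} (f : X ⟶ Y) :
    ∃ (Z : C) (g : Y ⟶ Z) (h : Z ⟶ X⟦(1 : ℤ)⟧), IsDist f g h :=
  distinguished_cocone_triangle f

lemma isDist_biprod (X Y : C) : IsDist (biprod.inl : X ⟶ X ⊞ Y) biprod.snd 0 :=
  binaryBiproductTriangle_distinguished X Y

lemma isDist_biprod' (X Y : C) : IsDist (biprod.inr : Y ⟶ X ⊞ Y) biprod.fst 0 :=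
  (isDist_biprod Y X).of_iso (Iso.refl _) (biprod.braiding _ _) (Iso.refl _)
    (by ext <;> simp) (by simp) (by simp)

open ZeroObject

lemma isDist_id (X : C) : IsDist (𝟙 X) (0 : X ⟶ 0) 0 := contractible_distinguished X

lemma isDist_shift_id (X : C) : IsDist (0 : X ⟶ 0) 0 (𝟙 (X⟦(1 : ℤ)⟧)) :=
  contractible_distinguished₂ X

lemma biprod_shift_hom_ext {X Y Z : C} {f g : Z ⟶ (X ⊞ Y)⟦(1 : ℤ)⟧}
    (h₁ : f ≫ biprod.fst⟦(1 : ℤ)⟧' = g ≫ biprod.fst⟦(1 : ℤ)⟧')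
    (h₂ : f ≫ biprod.snd⟦(1 : ℤ)⟧' = g ≫ biprod.snd⟦(1 : ℤ)⟧') : f = g := by
  have key : (biprod.fst ≫ biprod.inl + biprod.snd ≫ biprod.inr : X ⊞ Y ⟶ _)⟦(1 : ℤ)⟧' = 𝟙 _ := by
    rw [biprod.total, CategoryTheory.Functor.map_id]
  rw [← Category.comp_id f, ← Category.comp_id g, ← key]
  simp only [Functor.map_add, Functor.map_comp, Preadditive.comp_add, reassoc_of% h₁,
    reassoc_of% h₂]

end Triangles

/-! ### Homotopy cartesian squares from the octahedral axiom -/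

section HomotopyCartesian

open Pretriangulated

variable {C : Type w} [Category.{v} C] [Preadditive C] [HasZeroObject C] [HasShift C ℤ]
  [∀ n : ℤ, (shiftFunctor C n).Additive] [Pretriangulated C]

/-- A factorization `u ≫ v` of the connecting morphism of a triangle gives rise to a homotopy
cartesian square, compatible with the given triangles. -/
theorem IsDist.exists_homotopyCartesian [IsTriangulated C] {A B D E X : C} {j : A ⟶ B} {c : B ⟶ X}
    {i : A ⟶ E} {e : E ⟶ D} {v : D ⟶ A⟦(1 : ℤ)⟧} {u : X ⟶ D}
    (hB : IsDist j c (u ≫ v)) (hE : IsDist i e v) :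
    ∃ n : B ⟶ E, j ≫ n = i ∧
      IsDist (biprod.lift c n) (biprod.desc (-u) e) (v ≫ j⟦(1 : ℤ)⟧') := by
  obtain ⟨Z, p, r, hq⟩ := exists_isDist (biprod.desc (-u) e)
  -- The factorization of e as `biprod.inr` followed by (-u, e) yields a triangle X ⟶ ΣA ⟶ Z whose
  -- first morphism is -(u ≫ v). Rotating `hB` gives another triangle on the same morphism, with
  -- third object ΣB; hence Z ≅ ΣB, and the desired morphism B ⟶ X ⊞ E is obtained by desuspension.
  have oct := Triangulated.someOctahedron (biprod.inr_desc (-u) e) (isDist_biprod' X E) hq hE.rotate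
  have hm₁ : oct.m₁ = -(u ≫ v) := by
    have h := oct.comm₁
    simpa using (biprod.inl : X ⟶ X ⊞ E) ≫= h
  have h₁ : IsDist (-(u ≫ v)) oct.m₃ (r ≫ biprod.fst⟦(1 : ℤ)⟧') := by
    rw [← hm₁]; exact oct.mem
  have h₂ : IsDist (-(u ≫ v)) (j⟦(1 : ℤ)⟧') (-c⟦(1 : ℤ)⟧') := by
    simpa using hB.rotate.rotate.neg₁₂
  obtain ⟨θ, hθ₁, hθ₂⟩ := h₁.exists_iso₃ h₂ (Iso.refl _) (Iso.refl _) (by simp)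
  simp only [Iso.refl_hom, CategoryTheory.Functor.map_id, Category.comp_id,
    Category.id_comp] at hθ₁ hθ₂
  have h₃ : IsDist (biprod.desc (-u) e) (v ≫ j⟦(1 : ℤ)⟧') (θ.inv ≫ r) := by
    refine hq.of_iso (Iso.refl _) (Iso.refl _) θ (by simp) ?_ (by simp)
    rw [← oct.comm₃, Category.assoc, hθ₁, Iso.refl_hom, Category.id_comp]
  obtain ⟨k, hk⟩ := (shiftFunctor C (1 : ℤ)).map_surjective (-(θ.inv ≫ r))
  have hk₁ : k ≫ biprod.fst = c := by
    apply (shiftFunctor C (1 : ℤ)).map_injective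
    simp [hk, hθ₂]
  have hk₂ : j ≫ k = i ≫ biprod.inr := by
    apply (shiftFunctor C (1 : ℤ)).map_injective
    have h₄ := oct.comm₄
    rw [Preadditive.neg_comp, neg_eq_iff_eq_neg] at h₄
    rw [Functor.map_comp, Functor.map_comp, h₄, hk, ← hθ₁]
    simp
  refine ⟨k ≫ biprod.snd, by simp [reassoc_of% hk₂], ?_⟩
  have : biprod.lift c (k ≫ biprod.snd) = k := by
    ext <;> simp [hk₁]
  rw [this]
  apply IsDist.of_rotate
  simpa [hk] using h₃

end HomotopyCartesian

/-! ### Direct sums and direct summands of triangles -/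

section Biproducts

open Pretriangulated ZeroObject

variable {C : Type w} [Category.{v} C] [Preadditive C] [HasZeroObject C] [HasShift C ℤ]
  [∀ n : ℤ, (shiftFunctor C n).Additive] [Pretriangulated C]

variable {X Y Z X' Y' Z' : C} {f : X ⟶ Y} {g : Y ⟶ Z} {h : Z ⟶ X⟦(1 : ℤ)⟧}
  {f' : X' ⟶ Y'} {g' : Y' ⟶ Z'} {h' : Z' ⟶ X'⟦(1 : ℤ)⟧}

/-- A biproduct of two objects is the product of the corresponding family. -/
noncomputable def piBoolIso (W : Bool → C) : ∏ᶜ W ≅ W true ⊞ W false where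
  hom := biprod.lift (Pi.π W true) (Pi.π W false)
  inv := Pi.lift (fun b => match b with
    | true => biprod.fst
    | false => biprod.snd)
  hom_inv_id := by
    refine Pi.hom_ext _ _ fun b => ?_
    cases b <;> simp
  inv_hom_id := by ext <;> simp

lemma IsDist.biprod (H : IsDist f g h) (H' : IsDist f' g' h') :
    IsDist (biprod.map f f') (biprod.map g g')
      (biprod.desc (h ≫ biprod.inl⟦(1 : ℤ)⟧') (h' ≫ biprod.inr⟦(1 : ℤ)⟧')) := by
  let T : Bool → Triangle C := fun b => match b with
    | true => Triangle.mk f g h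
    | false => Triangle.mk f' g' h'
  have hT : productTriangle T ∈ distTriang C :=
    productTriangle_distinguished T (by rintro (_ | _) <;> assumption)
  have key : ∀ (W : Bool → C) , ∃ e : ∏ᶜ W ≅ W true ⊞ W false,
      e.hom ≫ biprod.fst = Pi.π W true ∧ e.hom ≫ biprod.snd = Pi.π W false :=
    fun W => ⟨piBoolIso W, biprod.lift_fst _ _, biprod.lift_snd _ _⟩
  obtain ⟨e₁, l₁, r₁⟩ : ∃ e₁ : (productTriangle T).obj₁ ≅ X ⊞ X',
    e₁.hom ≫ biprod.fst = (productTriangle.π T true).hom₁ ∧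
      e₁.hom ≫ biprod.snd = (productTriangle.π T false).hom₁ := key fun b => (T b).obj₁
  obtain ⟨e₂, l₂, r₂⟩ : ∃ e₂ : (productTriangle T).obj₂ ≅ Y ⊞ Y',
    e₂.hom ≫ biprod.fst = (productTriangle.π T true).hom₂ ∧
      e₂.hom ≫ biprod.snd = (productTriangle.π T false).hom₂ := key fun b => (T b).obj₂
  obtain ⟨e₃, l₃, r₃⟩ : ∃ e₃ : (productTriangle T).obj₃ ≅ Z ⊞ Z',
    e₃.hom ≫ biprod.fst = (productTriangle.π T true).hom₃ ∧
      e₃.hom ≫ biprod.snd = (productTriangle.π T false).hom₃ := key fun b => (T b).obj₃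
  have a₁ : _ = _ ≫ f := (productTriangle.π T true).comm₁
  have a₂ : _ = _ ≫ g := (productTriangle.π T true).comm₂
  have a₃ : _ = _ ≫ h := (productTriangle.π T true).comm₃
  have b₁ : _ = _ ≫ f' := (productTriangle.π T false).comm₁
  have b₂ : _ = _ ≫ g' := (productTriangle.π T false).comm₂
  have b₃ : _ = _ ≫ h' := (productTriangle.π T false).comm₃
  rw [← l₁] at a₁ a₃
  rw [← l₂] at a₁ a₂
  rw [← l₃] at a₂ a₃
  rw [← r₁] at b₁ b₃
  rw [← r₂] at b₁ b₂
  rw [← r₃] at b₂ b₃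
  obtain ⟨P, hP, e₁, e₂, e₃, a₁, a₂, a₃, b₁, b₂, b₃⟩ : ∃ P : Triangle C, P ∈ distTriang C ∧
      ∃ (e₁ : P.obj₁ ≅ X ⊞ X') (e₂ : P.obj₂ ≅ Y ⊞ Y') (e₃ : P.obj₃ ≅ Z ⊞ Z'),
      P.mor₁ ≫ e₂.hom ≫ biprod.fst = (e₁.hom ≫ biprod.fst) ≫ f ∧
      P.mor₂ ≫ e₃.hom ≫ biprod.fst = (e₂.hom ≫ biprod.fst) ≫ g ∧
      P.mor₃ ≫ (e₁.hom ≫ biprod.fst)⟦(1 : ℤ)⟧' = (e₃.hom ≫ biprod.fst) ≫ h ∧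
      P.mor₁ ≫ e₂.hom ≫ biprod.snd = (e₁.hom ≫ biprod.snd) ≫ f' ∧
      P.mor₂ ≫ e₃.hom ≫ biprod.snd = (e₂.hom ≫ biprod.snd) ≫ g' ∧
      P.mor₃ ≫ (e₁.hom ≫ biprod.snd)⟦(1 : ℤ)⟧' = (e₃.hom ≫ biprod.snd) ≫ h' :=
    ⟨productTriangle T, hT, e₁, e₂, e₃, a₁, a₂, a₃, b₁, b₂, b₃⟩
  refine IsDist.of_iso (hP : IsDist P.mor₁ P.mor₂ P.mor₃) e₁ e₂ e₃ ?_ ?_ ?_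
  · apply biprod.hom_ext
    · simpa using a₁
    · simpa using b₁
  · apply biprod.hom_ext
    · simpa using a₂
    · simpa using b₂
  · have key' : biprod.desc (h ≫ biprod.inl⟦(1 : ℤ)⟧') (h' ≫ biprod.inr⟦(1 : ℤ)⟧') =
        biprod.fst ≫ h ≫ biprod.inl⟦(1 : ℤ)⟧' + biprod.snd ≫ h' ≫ biprod.inr⟦(1 : ℤ)⟧' := by
      ext <;> simp
    apply biprod_shift_hom_ext
    · simpa [key', ← Functor.map_comp] using a₃
    · simpa [key', ← Functor.map_comp] using b₃

lemma isIso_of_isIso_biprod_map {a : X ⟶ Y} {b : X' ⟶ Y'} (_ : IsIso (biprod.map a b)) :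
    IsIso a := by
  refine ⟨biprod.inl ≫ inv (biprod.map a b) ≫ biprod.fst, ?_, ?_⟩
  · rw [← biprod.inl_map_assoc a b, IsIso.hom_inv_id_assoc, biprod.inl_fst]
  · rw [Category.assoc, Category.assoc, ← biprod.map_fst a b, IsIso.inv_hom_id_assoc,
      biprod.inl_fst]

/-- Cones of f and f' map to the given sum along the two inclusions. The diagonal parts of these
maps assemble to a morphism of triangles that is the identity on the first two terms, hence an
isomorphism on the third; so each diagonal part is an isomorphism. -/
lemma IsDist.of_biprod_left
    (H : IsDist (biprod.map f f') (biprod.map g g')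
      (biprod.desc (h ≫ biprod.inl⟦(1 : ℤ)⟧') (h' ≫ biprod.inr⟦(1 : ℤ)⟧'))) :
    IsDist f g h := by
  obtain ⟨W, a, b, hW⟩ := exists_isDist f
  obtain ⟨W', a', b', hW'⟩ := exists_isDist f'
  have key' : biprod.desc (h ≫ biprod.inl⟦(1 : ℤ)⟧') (h' ≫ biprod.inr⟦(1 : ℤ)⟧') =
      biprod.fst ≫ h ≫ biprod.inl⟦(1 : ℤ)⟧' + biprod.snd ≫ h' ≫ biprod.inr⟦(1 : ℤ)⟧' := by
    ext <;> simp
  obtain ⟨c, hc₁, hc₂⟩ := hW.exists_hom₃ H biprod.inl biprod.inl (by simp)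
  obtain ⟨c', hc₁', hc₂'⟩ := hW'.exists_hom₃ H biprod.inr biprod.inr (by simp)
  replace hc₁ := hc₁ =≫ biprod.fst
  replace hc₁' := hc₁' =≫ biprod.snd
  replace hc₂ := hc₂ =≫ biprod.fst⟦(1 : ℤ)⟧'
  replace hc₂' := hc₂' =≫ biprod.snd⟦(1 : ℤ)⟧'
  simp only [key', Category.assoc, Preadditive.add_comp, ← Functor.map_comp, biprod.inl_fst,
    biprod.inl_snd, biprod.inr_fst, biprod.inr_snd, biprod.map_fst, biprod.map_snd,
    CategoryTheory.Functor.map_id, Functor.map_zero, comp_zero, add_zero, zero_add,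
    Category.comp_id, biprod.inl_fst_assoc, biprod.inr_snd_assoc] at hc₁ hc₁' hc₂ hc₂'
  have : IsIso (biprod.map (c ≫ biprod.fst) (c' ≫ biprod.snd)) := by
    refine (hW.biprod hW').isIso₃ H (𝟙 _) (𝟙 _) _ (by simp) ?_ ?_
    · ext <;> simp [hc₁, hc₁']
    · ext1
      · simp [reassoc_of% hc₂]
      · simp [reassoc_of% hc₂']
  have := isIso_of_isIso_biprod_map this
  exact hW.of_iso (Iso.refl _) (Iso.refl _) (asIso (c ≫ biprod.fst)) (by simp) (by simp [hc₁])
    (by simp [hc₂])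

end Biproducts

/-! ### Completions of partial morphisms of triangles with distinguished mapping cone -/

section Cone

open Pretriangulated ZeroObject

variable {C : Type w} [Category.{v} C] [Preadditive C] [HasZeroObject C] [HasShift C ℤ]
  [∀ n : ℤ, (shiftFunctor C n).Additive] [Pretriangulated C] [IsTriangulated C]

variable {X₁ X₂ X₃ Y₁ Y₂ Y₃ : C} {f₁ : X₁ ⟶ X₂} {f₂ : X₂ ⟶ X₃} {f₃ : X₃ ⟶ X₁⟦(1 : ℤ)⟧}
  {g₁ : Y₁ ⟶ Y₂} {g₂ : Y₂ ⟶ Y₃} {g₃ : Y₃ ⟶ Y₁⟦(1 : ℤ)⟧}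

omit [IsTriangulated C] in
-- The sum of X ⟶ 0 ⟶ ΣX with the given triangle. In the cone constructions it is the second input
-- of `IsDist.exists_homotopyCartesian`.
lemma isDist_shift_biprod (X : C) (hY : IsDist g₁ g₂ g₃) :
    IsDist (biprod.desc 0 g₁ : X ⊞ Y₁ ⟶ Y₂) (biprod.lift 0 g₂)
      (biprod.desc (biprod.inl⟦(1 : ℤ)⟧') (g₃ ≫ biprod.inr⟦(1 : ℤ)⟧')) := by
  refine ((isDist_shift_id X).biprod hY).of_iso (Iso.refl _)
    ⟨biprod.snd, biprod.inr, by ext <;> simp, by simp⟩ (Iso.refl _) ?_ ?_ ?_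
  · ext <;> simp
  · ext <;> simp
  · ext1 <;> simp

/-- A partial morphism of triangles with the middle component missing can be completed such that
its mapping cone is distinguished. -/
theorem IsDist.exists_cone₂ (hX : IsDist f₁ f₂ f₃) (hY : IsDist g₁ g₂ g₃) (φ₁ : X₁ ⟶ Y₁)
    (φ₃ : X₃ ⟶ Y₃) (h : f₃ ≫ φ₁⟦(1 : ℤ)⟧' = φ₃ ≫ g₃) :
    ∃ φ₂ : X₂ ⟶ Y₂, f₁ ≫ φ₂ = φ₁ ≫ g₁ ∧ f₂ ≫ φ₃ = φ₂ ≫ g₂ ∧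
      IsDist (biprod.desc (biprod.lift (-f₂) φ₂) (biprod.lift 0 g₁))
        (biprod.desc (biprod.lift (-f₃) φ₃) (biprod.lift 0 g₂))
        (biprod.desc (-f₁⟦(1 : ℤ)⟧' ≫ biprod.inl⟦(1 : ℤ)⟧' + φ₁⟦(1 : ℤ)⟧' ≫ biprod.inr⟦(1 : ℤ)⟧')
          (g₃ ≫ biprod.inr⟦(1 : ℤ)⟧')) := by
  have hE := isDist_shift_biprod X₁ hY
  -- An involution. It turns the sum of the X-triangle and the identity triangle of Y₁ into one
  -- whose connecting morphism, thanks to `h`, factors through (f₃, -φ₃) and the connecting morphism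
  -- of `hE`.
  let σ : X₁ ⊞ Y₁ ≅ X₁ ⊞ Y₁ :=
    ⟨biprod.desc (biprod.lift (-𝟙 _) φ₁) biprod.inr, biprod.desc (biprod.lift (-𝟙 _) φ₁) biprod.inr,
      by ext <;> simp, by ext <;> simp⟩
  have hB : IsDist (biprod.desc (biprod.lift (-f₁) φ₁) biprod.inr : X₁ ⊞ Y₁ ⟶ X₂ ⊞ Y₁)
      (biprod.desc (-f₂) 0 : X₂ ⊞ Y₁ ⟶ X₃) (biprod.lift f₃ (-φ₃) ≫
        (biprod.desc (biprod.inl⟦(1 : ℤ)⟧') (g₃ ≫ biprod.inr⟦(1 : ℤ)⟧'))) := by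
    refine (hX.neg₂₃.biprod (isDist_id Y₁)).of_iso σ (Iso.refl _)
      ⟨biprod.fst, biprod.inl, by ext <;> simp, by simp⟩ ?_ ?_ ?_
    · ext <;> simp [σ]
    · ext <;> simp
    · ext1
      · have : (biprod.inl : X₁ ⟶ X₁ ⊞ Y₁) ≫ σ.hom = -biprod.inl + φ₁ ≫ biprod.inr := by
          ext <;> simp [σ]
        simp [← Functor.map_comp, this, biprod.lift_desc, ← reassoc_of% h, add_comm]
      · simp
  obtain ⟨n, hn, hd⟩ := hB.exists_homotopyCartesian hE
  have hn₁ := biprod.inl ≫= hn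
  have hn₂ := biprod.inr ≫= hn
  simp [biprod.lift_eq] at hn₁ hn₂
  have e₁ : biprod.lift (biprod.desc (-f₂) 0) n =
      biprod.desc (biprod.lift (-f₂) (biprod.inl ≫ n)) (biprod.lift 0 g₁) := by
    ext <;> simp [hn₂]
  have e₂ : biprod.desc (-biprod.lift f₃ (-φ₃)) (biprod.lift 0 g₂) =
    biprod.desc (biprod.lift (-f₃) φ₃) (biprod.lift 0 g₂) := by ext <;> simp
  rw [e₁, e₂] at hd
  have h₁₂ := (biprod.inl ≫= hd.zero₁₂) =≫ biprod.snd
  simp at h₁₂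
  refine ⟨biprod.inl ≫ n, ?_, ?_, ?_⟩
  · rw [hn₂] at hn₁
    exact neg_add_eq_zero.1 hn₁
  · rw [Category.assoc]
    exact neg_add_eq_zero.1 h₁₂
  · convert hd using 1
    ext1
    · have : biprod.lift (-f₁) φ₁ = -(f₁ ≫ biprod.inl) + φ₁ ≫ biprod.inr := by
        ext <;> simp
      simp [← Functor.map_comp, this]
    · simp [← Functor.map_comp]

/-- A partial morphism of triangles with the last component missing can be completed such that
its mapping cone is distinguished. -/
theorem IsDist.exists_cone₃ (hX : IsDist f₁ f₂ f₃) (hY : IsDist g₁ g₂ g₃) (φ₁ : X₁ ⟶ Y₁)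
    (φ₂ : X₂ ⟶ Y₂) (h : f₁ ≫ φ₂ = φ₁ ≫ g₁) :
    ∃ φ₃ : X₃ ⟶ Y₃, f₂ ≫ φ₃ = φ₂ ≫ g₂ ∧ f₃ ≫ φ₁⟦(1 : ℤ)⟧' = φ₃ ≫ g₃ ∧
      IsDist (biprod.desc (biprod.lift (-f₂) φ₂) (biprod.lift 0 g₁))
        (biprod.desc (biprod.lift (-f₃) φ₃) (biprod.lift 0 g₂))
        (biprod.desc (-f₁⟦(1 : ℤ)⟧' ≫ biprod.inl⟦(1 : ℤ)⟧' + φ₁⟦(1 : ℤ)⟧' ≫ biprod.inr⟦(1 : ℤ)⟧')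
          (g₃ ≫ biprod.inr⟦(1 : ℤ)⟧')) := by
  -- After rotation the missing third component becomes the middle one. The cone of the rotated
  -- morphism is the rotated cone up to the sign in `e`.
  obtain ⟨φ₃, h₁, h₂, hd⟩ := hX.rotate.exists_cone₂ hY.rotate φ₂ (φ₁⟦(1 : ℤ)⟧')
    (by simp [← Functor.map_comp, h])
  refine ⟨φ₃, h₁, h₂, ?_⟩
  let e : X₂⟦(1 : ℤ)⟧ ⊞ Y₁⟦(1 : ℤ)⟧ ≅ (X₂ ⊞ Y₁)⟦(1 : ℤ)⟧ :=
    ⟨biprod.desc (-biprod.inl⟦(1 : ℤ)⟧') (biprod.inr⟦(1 : ℤ)⟧'),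
      biprod.lift (-biprod.fst⟦(1 : ℤ)⟧') (biprod.snd⟦(1 : ℤ)⟧'),
      by ext <;> simp [← Functor.map_comp], by
        rw [biprod.lift_desc, Preadditive.neg_comp_neg, ← Functor.map_comp, ← Functor.map_comp,
          ← Functor.map_add, biprod.total, CategoryTheory.Functor.map_id]⟩
  apply IsDist.of_rotate
  refine hd.of_iso (Iso.refl _) (Iso.refl _) e (by simp) ?_ ?_
  · ext1
    · simp [e, biprod.lift_desc]
    · simp [e, biprod.lift_desc]
  · have h₃ : ∀ (U : C) (a : U ⟶ X₃) (b : U ⟶ Y₂), biprod.lift a b = a ≫ biprod.inl + b ≫ biprod.inr := by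
      intro U a b; ext <;> simp
    ext1
    · simp [e, ← Functor.map_comp, h₃]
    · simp [e, ← Functor.map_comp, h₃]

end Cone

/-! ### Sequences spliced from two triangles -/

section Quad

open Pretriangulated

variable {C : Type w} [Category.{v} C] [Preadditive C] [HasZeroObject C] [HasShift C ℤ]
  [∀ n : ℤ, (shiftFunctor C n).Additive] [Pretriangulated C]

/-- A sequence `X₁ ⟶ X₂ ⟶ X₃ ⟶ X₄ ⟶ X₁⟦1⟧⟦1⟧` which is spliced from two distinguished
triangles `X₁ ⟶ X₂ ⟶ M ⟶ X₁⟦1⟧` and `M ⟶ X₃ ⟶ X₄ ⟶ M⟦1⟧`. -/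
def IsQuad {X₁ X₂ X₃ X₄ : C} (f₁ : X₁ ⟶ X₂) (f₂ : X₂ ⟶ X₃) (f₃ : X₃ ⟶ X₄)
    (f₄ : X₄ ⟶ X₁⟦(1 : ℤ)⟧⟦(1 : ℤ)⟧) : Prop :=
  ∃ (M : C) (a : X₂ ⟶ M) (b : M ⟶ X₁⟦(1 : ℤ)⟧) (m : M ⟶ X₃) (d : X₄ ⟶ M⟦(1 : ℤ)⟧),
    IsDist f₁ a b ∧ IsDist m f₃ d ∧ a ≫ m = f₂ ∧ d ≫ b⟦(1 : ℤ)⟧' = f₄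

namespace IsQuad

variable {X₁ X₂ X₃ X₄ Y₁ Y₂ Y₃ Y₄ : C} {f₁ : X₁ ⟶ X₂} {f₂ : X₂ ⟶ X₃} {f₃ : X₃ ⟶ X₄}
  {f₄ : X₄ ⟶ X₁⟦(1 : ℤ)⟧⟦(1 : ℤ)⟧} {g₁ : Y₁ ⟶ Y₂} {g₂ : Y₂ ⟶ Y₃} {g₃ : Y₃ ⟶ Y₄}
  {g₄ : Y₄ ⟶ Y₁⟦(1 : ℤ)⟧⟦(1 : ℤ)⟧}

lemma of_iso (H : IsQuad f₁ f₂ f₃ f₄) (e₁ : X₁ ≅ Y₁) (e₂ : X₂ ≅ Y₂) (e₃ : X₃ ≅ Y₃) (e₄ : X₄ ≅ Y₄)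
    (c₁ : f₁ ≫ e₂.hom = e₁.hom ≫ g₁) (c₂ : f₂ ≫ e₃.hom = e₂.hom ≫ g₂)
    (c₃ : f₃ ≫ e₄.hom = e₃.hom ≫ g₃)
    (c₄ : f₄ ≫ e₁.hom⟦(1 : ℤ)⟧'⟦(1 : ℤ)⟧' = e₄.hom ≫ g₄) : IsQuad g₁ g₂ g₃ g₄ := by
  obtain ⟨M, a, b, m, d, h₁, h₂, h₃, h₄⟩ := H
  refine ⟨M, e₂.inv ≫ a, b ≫ e₁.hom⟦(1 : ℤ)⟧', m ≫ e₃.hom, e₄.inv ≫ d,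
    h₁.of_iso e₁ e₂ (Iso.refl _) c₁ (by simp) (by simp),
    h₂.of_iso (Iso.refl _) e₃ e₄ (by simp) c₃ (by simp), ?_, ?_⟩
  · rw [Category.assoc, reassoc_of% h₃, c₂, e₂.inv_hom_id_assoc]
  · rw [Category.assoc, Functor.map_comp, reassoc_of% h₄, c₄, e₄.inv_hom_id_assoc]

/-- The octahedron on f₂ = a ≫ m relates the cones ΣX₁, N and X₄ of a, f₂ and m by a triangle ΣX₁ ⟶
N ⟶ X₄ with connecting morphism f₄; N is the new splicing object. -/
lemma rotate [IsTriangulated C] (H : IsQuad f₁ f₂ f₃ f₄) :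
    IsQuad f₂ f₃ f₄ (f₁⟦(1 : ℤ)⟧'⟦(1 : ℤ)⟧') := by
  obtain ⟨M, a, b, m, d, h₁, h₂, h₃, h₄⟩ := H
  obtain ⟨N, p, q, hN⟩ := exists_isDist f₂
  have oct := Triangulated.someOctahedron h₃ h₁.rotate h₂ hN
  have hm : IsDist oct.m₁ oct.m₃ f₄ := by rw [← h₄]; exact oct.mem
  exact ⟨N, p, q, oct.m₃, _, hN, hm.rotate, oct.comm₃, by simp [← Functor.map_comp, oct.comm₂]⟩

/-- The splicing object is now a cone M of f₁. Desuspending d exhibits -Σf₁ as a composite ΣX₁ ⟶ N ⟶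
ΣX₂, whose octahedron gives a triangle X₄ ⟶ ΣM ⟶ ΣX₃; rotated back and desuspended, it is the
missing triangle M ⟶ X₃ ⟶ X₄. -/
lemma of_rotate [IsTriangulated C] (H : IsQuad f₂ f₃ f₄ (f₁⟦(1 : ℤ)⟧'⟦(1 : ℤ)⟧')) :
    IsQuad f₁ f₂ f₃ f₄ := by
  obtain ⟨N, p, q, m, d, h₁, h₂, h₃, h₄⟩ := H
  obtain ⟨c, hc⟩ := (shiftFunctor C (1 : ℤ)).map_surjective (-d)
  have hc₁ : IsDist c m f₄ := IsDist.of_rotate (by simpa [hc] using h₂)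
  have hc₂ : c ≫ q = -f₁⟦(1 : ℤ)⟧' := by
    apply (shiftFunctor C (1 : ℤ)).map_injective
    simp [hc, h₄]
  obtain ⟨M, a, b, hM⟩ := exists_isDist f₁
  have oct := Triangulated.someOctahedron hc₂ hc₁ h₁.rotate.rotate hM.rotate.rotate.rotate
  obtain ⟨t, ht⟩ := (shiftFunctor C (1 : ℤ)).map_surjective oct.m₃
  have hmem : IsDist oct.m₁ (t⟦(1 : ℤ)⟧') (-f₃⟦(1 : ℤ)⟧') := by
    have : IsDist oct.m₁ oct.m₃ ((-p⟦(1 : ℤ)⟧') ≫ m⟦(1 : ℤ)⟧') := oct.mem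
    simpa [ht, ← Functor.map_comp, h₃] using this
  refine ⟨M, a, b, t, -oct.m₁, hM, hmem.neg₁₂.of_rotate.of_rotate, ?_, ?_⟩
  · apply (shiftFunctor C (1 : ℤ)).map_injective
    simpa [ht] using oct.comm₃
  · simpa using oct.comm₂

lemma biprod (H : IsQuad f₁ f₂ f₃ f₄) (H' : IsQuad g₁ g₂ g₃ g₄) :
    IsQuad (biprod.map f₁ g₁) (biprod.map f₂ g₂) (biprod.map f₃ g₃)
      (biprod.desc (f₄ ≫ biprod.inl⟦(1 : ℤ)⟧'⟦(1 : ℤ)⟧')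
        (g₄ ≫ biprod.inr⟦(1 : ℤ)⟧'⟦(1 : ℤ)⟧')) := by
  obtain ⟨M, a, b, m, d, h₁, h₂, h₃, h₄⟩ := H
  obtain ⟨M', a', b', m', d', h₁', h₂', h₃', h₄'⟩ := H'
  refine ⟨_, _, _, _, _, h₁.biprod h₁', h₂.biprod h₂', ?_, ?_⟩
  · ext <;> simp [h₃, h₃']
  · ext1 <;> simp [← Functor.map_comp, ← h₄, ← h₄']

/-- The splicing object is a sum M₁ ⊞ M₂ of cones, but the second triangle need not be a sum a
priori. An off-diagonal entry of M₁ ⊞ M₂ ⟶ X₃ ⊞ Y₃ factors through ΣX₁ ⟶ Y₃ or ΣY₁ ⟶ X₃, and one of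
the connecting morphism through X₄ ⟶ ΣY₂ or Y₄ ⟶ ΣX₂. All of these vanish, so the triangle is
diagonal and `IsDist.of_biprod_left` applies. -/
lemma of_biprod_left
    (H : IsQuad (biprod.map f₁ g₁) (biprod.map f₂ g₂) (biprod.map f₃ g₃)
      (biprod.desc (f₄ ≫ biprod.inl⟦(1 : ℤ)⟧'⟦(1 : ℤ)⟧')
        (g₄ ≫ biprod.inr⟦(1 : ℤ)⟧'⟦(1 : ℤ)⟧')))
    (v₁ : ∀ t : X₁⟦(1 : ℤ)⟧ ⟶ Y₃, t = 0) (v₂ : ∀ t : Y₁⟦(1 : ℤ)⟧ ⟶ X₃, t = 0)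
    (v₃ : ∀ t : X₄ ⟶ Y₂⟦(1 : ℤ)⟧, t = 0) (v₄ : ∀ t : Y₄ ⟶ X₂⟦(1 : ℤ)⟧, t = 0) :
    IsQuad f₁ f₂ f₃ f₄ := by
  obtain ⟨M, a, b, m, d, h₁, h₂, h₃, h₄⟩ := H
  obtain ⟨M₁, a₁, b₁, hM₁⟩ := exists_isDist f₁
  obtain ⟨M₂, a₂, b₂, hM₂⟩ := exists_isDist g₁
  obtain ⟨c, hc₁, hc₂⟩ := (hM₁.biprod hM₂).exists_iso₃ h₁ (Iso.refl _) (Iso.refl _) (by simp)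
  simp only [Iso.refl_hom, CategoryTheory.Functor.map_id, Category.comp_id,
    Category.id_comp] at hc₁ hc₂
  obtain ⟨m', hm'⟩ : ∃ m', m' = c.hom ≫ m := ⟨_, rfl⟩
  obtain ⟨d', hd'⟩ : ∃ d', d' = d ≫ c.inv⟦(1 : ℤ)⟧' := ⟨_, rfl⟩
  have hd : IsDist m' (biprod.map f₃ g₃) d' :=
    h₂.of_iso c.symm (Iso.refl _) (Iso.refl _) (by simp [hm']) (by simp) (by simp [hd'])
  have hm : biprod.map a₁ a₂ ≫ m' = biprod.map f₂ g₂ := by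
    rw [hm', reassoc_of% hc₁, h₃]
  replace h₄ : d' ≫ (biprod.desc (b₁ ≫ biprod.inl⟦(1 : ℤ)⟧') (b₂ ≫ biprod.inr⟦(1 : ℤ)⟧'))⟦(1 : ℤ)⟧' =
    biprod.desc (f₄ ≫ biprod.inl⟦(1 : ℤ)⟧'⟦(1 : ℤ)⟧') (g₄ ≫ biprod.inr⟦(1 : ℤ)⟧'⟦(1 : ℤ)⟧') := by
    rw [← h₄, hd', hc₂, Category.assoc, ← Functor.map_comp, c.inv_hom_id_assoc]
  have kb : biprod.desc (b₁ ≫ biprod.inl⟦(1 : ℤ)⟧') (b₂ ≫ biprod.inr⟦(1 : ℤ)⟧') =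
      biprod.fst ≫ b₁ ≫ biprod.inl⟦(1 : ℤ)⟧' + biprod.snd ≫ b₂ ≫ biprod.inr⟦(1 : ℤ)⟧' := by
    ext <;> simp
  have hl := h₄ =≫ biprod.fst⟦(1 : ℤ)⟧'⟦(1 : ℤ)⟧'
  have hr := h₄ =≫ biprod.snd⟦(1 : ℤ)⟧'⟦(1 : ℤ)⟧'
  simp only [kb, Category.assoc, Preadditive.add_comp, ← Functor.map_comp, biprod.inl_fst,
    biprod.inl_snd, biprod.inr_fst, biprod.inr_snd, CategoryTheory.Functor.map_id,
    Functor.map_zero, comp_zero, add_zero, zero_add, Category.comp_id] at hl hr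
  have hl₁ := biprod.inl ≫= hl
  have hl₂ := biprod.inr ≫= hl
  have hr₁ := biprod.inl ≫= hr
  have hr₂ := biprod.inr ≫= hr
  simp [← Functor.map_comp] at hl₁ hl₂ hr₁ hr₂
  have hz : ∀ {U V W : C} {x : U ⟶ V} {y : V ⟶ W} {z : W ⟶ U⟦(1 : ℤ)⟧} (_ : IsDist x y z) {A : C}
      (_ : ∀ t : A ⟶ V⟦(1 : ℤ)⟧, t = 0) (t : A ⟶ W⟦(1 : ℤ)⟧), t ≫ z⟦(1 : ℤ)⟧' = 0 → t = 0 := by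
    intro U V W x y z h A hA t ht
    obtain ⟨s, rfl⟩ := h.rotate.rotate.exists_lift₁ t ht
    simp [hA s]
  have hm₁ : biprod.inl ≫ m' ≫ biprod.snd = 0 := by
    obtain ⟨s, hs⟩ := hM₁.exists_desc₃ (biprod.inl ≫ m' ≫ biprod.snd)
      (by simpa using (biprod.inl ≫= hm) =≫ biprod.snd)
    rw [← hs, v₁ s, comp_zero]
  have hm₂ : biprod.inr ≫ m' ≫ biprod.fst = 0 := by
    obtain ⟨s, hs⟩ := hM₂.exists_desc₃ (biprod.inr ≫ m' ≫ biprod.fst)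
      (by simpa using (biprod.inr ≫= hm) =≫ biprod.fst)
    rw [← hs, v₂ s, comp_zero]
  have hd₁ : biprod.inl ≫ d' ≫ biprod.snd⟦(1 : ℤ)⟧' = 0 :=
    hz hM₂ v₃ _ (by simpa [← Functor.map_comp] using hr₁)
  have hd₂ : biprod.inr ≫ d' ≫ biprod.fst⟦(1 : ℤ)⟧' = 0 :=
    hz hM₁ v₄ _ (by simpa [← Functor.map_comp] using hl₂)
  have em : m' = biprod.map (biprod.inl ≫ m' ≫ biprod.fst) (biprod.inr ≫ m' ≫ biprod.snd) := by
    ext <;> simp [hm₁, hm₂]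
  have ed : d' = biprod.desc ((biprod.inl ≫ d' ≫ biprod.fst⟦(1 : ℤ)⟧') ≫ biprod.inl⟦(1 : ℤ)⟧')
      ((biprod.inr ≫ d' ≫ biprod.snd⟦(1 : ℤ)⟧') ≫ biprod.inr⟦(1 : ℤ)⟧') := by
    ext1
    · apply biprod_shift_hom_ext <;> simp [← Functor.map_comp, hd₁]
    · apply biprod_shift_hom_ext <;> simp [← Functor.map_comp, hd₂]
  rw [em, ed] at hd
  refine ⟨M₁, a₁, b₁, _, _, hM₁, hd.of_biprod_left, ?_, ?_⟩
  · simpa using (biprod.inl ≫= hm) =≫ biprod.fst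
  · simpa [← Functor.map_comp] using hl₁

/-- X₃ is a left approximation of the cone M of f₁, and X₄ is the cone of M ⟶ X₃. A morphism X₄ ⟶ ΣN
with N in P vanishes on X₃, so it factors through ΣM; the resulting M ⟶ N extends over the
approximation, hence the composite is zero and X₄ lies in P. -/
lemma exists_of_approximation (P : ObjectProperty C)
    (happ : ∀ X : C, ∃ (M : C) (i : X ⟶ M), P M ∧ ∀ (N : C) (f : X ⟶ N), P N → ∃ g : M ⟶ N, i ≫ g = f)
    (hP : ∀ X : C, P X ↔ ∀ N : C, P N → ∀ f : X ⟶ N⟦(1 : ℤ)⟧, f = 0) (f₁ : X₁ ⟶ X₂) :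
    ∃ (X₃ X₄ : C) (f₂ : X₂ ⟶ X₃) (f₃ : X₃ ⟶ X₄) (f₄ : X₄ ⟶ X₁⟦(1 : ℤ)⟧⟦(1 : ℤ)⟧),
      P X₃ ∧ P X₄ ∧ IsQuad f₁ f₂ f₃ f₄ := by
  obtain ⟨M, a, b, hM⟩ := exists_isDist f₁
  obtain ⟨X₃, m, hX₃, hm⟩ := happ M
  obtain ⟨X₄, f₃, d, hd⟩ := exists_isDist m
  refine ⟨X₃, X₄, _, f₃, _, hX₃, ?_, M, a, b, m, d, hM, hd, rfl, rfl⟩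
  rw [hP]
  intro N hN f
  obtain ⟨s, rfl⟩ := hd.exists_desc₃ f ((hP X₃).1 hX₃ N hN _)
  obtain ⟨s, rfl⟩ := (shiftFunctor C (1 : ℤ)).map_surjective s
  obtain ⟨t, rfl⟩ := hm N s hN
  rw [Functor.map_comp, reassoc_of% hd.zero₃₁, zero_comp]

/-- A good completion φ of the first triangles makes their mapping cone distinguished. An octahedron
replaces the splicing objects by the cone N of the first morphism of the cone sequence, and a
homotopy cartesian square produces φ₃ together with the second triangle N ⟶ X₄ ⊞ Y₃ ⟶ Σ²X₁ ⊞ Y₄. -/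
lemma exists_cone [IsTriangulated C] (HX : IsQuad f₁ f₂ f₃ f₄) (HY : IsQuad g₁ g₂ g₃ g₄)
    (hv : ∀ t : X₄ ⟶ Y₃⟦(1 : ℤ)⟧, t = 0) (φ₁ : X₁ ⟶ Y₁) (φ₂ : X₂ ⟶ Y₂)
    (comm : f₁ ≫ φ₂ = φ₁ ≫ g₁) :
    ∃ (φ₃ : X₃ ⟶ Y₃) (φ₄ : X₄ ⟶ Y₄), f₂ ≫ φ₃ = φ₂ ≫ g₂ ∧ f₃ ≫ φ₄ = φ₃ ≫ g₃ ∧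
      f₄ ≫ φ₁⟦(1 : ℤ)⟧'⟦(1 : ℤ)⟧' = φ₄ ≫ g₄ ∧
      IsQuad (biprod.desc (biprod.lift (-f₂) φ₂) (biprod.lift 0 g₁))
        (biprod.desc (biprod.lift (-f₃) φ₃) (biprod.lift 0 g₂))
        (biprod.desc (biprod.lift (-f₄) φ₄) (biprod.lift 0 g₃))
        (biprod.desc (-f₁⟦(1 : ℤ)⟧'⟦(1 : ℤ)⟧' ≫ biprod.inl⟦(1 : ℤ)⟧'⟦(1 : ℤ)⟧' +
          φ₁⟦(1 : ℤ)⟧'⟦(1 : ℤ)⟧' ≫ biprod.inr⟦(1 : ℤ)⟧'⟦(1 : ℤ)⟧')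
          (g₄ ≫ biprod.inr⟦(1 : ℤ)⟧'⟦(1 : ℤ)⟧')) := by
  obtain ⟨M, a, b, m, d, h₁, h₂, h₃, h₄⟩ := HX
  obtain ⟨M', a', b', m', d', h₁', h₂', h₃', h₄'⟩ := HY
  obtain ⟨φ, hφ₁, hφ₂, hk⟩ := h₁.exists_cone₃ h₁' φ₁ φ₂ comm
  -- The obstruction to lifting d ≫ Σφ through d' is a morphism X₄ ⟶ ΣY₃.
  obtain ⟨φ₄, hφ₄⟩ := h₂'.exists_lift₁ (d ≫ φ⟦(1 : ℤ)⟧') (hv _)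
  have hs : IsDist (biprod.map m (𝟙 Y₂)) (biprod.desc (-f₃) 0 : X₃ ⊞ Y₂ ⟶ X₄)
      (-d ≫ biprod.inl⟦(1 : ℤ)⟧') :=
    (h₂.neg₂₃.biprod (isDist_id Y₂)).of_iso (Iso.refl _) (Iso.refl _)
      ⟨biprod.fst, biprod.inl, by ext <;> simp, by simp⟩ (by simp) (by ext <;> simp)
      (by ext1 <;> simp)
  obtain ⟨N, p, q, hN⟩ :=
    exists_isDist (biprod.desc (biprod.lift (-f₂) φ₂) (biprod.lift 0 g₁) : X₂ ⊞ Y₁ ⟶ X₃ ⊞ Y₂)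
  have oct := Triangulated.someOctahedron
    (by ext <;> simp [h₃] : biprod.desc (biprod.lift (-a) φ₂) (biprod.lift 0 g₁) ≫
      biprod.map m (𝟙 Y₂) = _) hk hs hN
  have hv : biprod.lift f₄ (-φ₄) ≫
      biprod.desc (biprod.inl⟦(1 : ℤ)⟧') (d' ≫ biprod.inr⟦(1 : ℤ)⟧') =
      (-d ≫ biprod.inl⟦(1 : ℤ)⟧') ≫
        (biprod.desc (biprod.lift (-b) φ) (biprod.lift 0 a'))⟦(1 : ℤ)⟧' := by
    have h₃ : biprod.lift (-b) φ = -(b ≫ biprod.inl) + φ ≫ biprod.inr := by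
      ext <;> simp
    simp [← Functor.map_comp, h₃, biprod.lift_desc, reassoc_of% hφ₄, ← h₄, add_comm]
  have hmem : IsDist oct.m₁ oct.m₃ (biprod.lift f₄ (-φ₄) ≫
      biprod.desc (biprod.inl⟦(1 : ℤ)⟧') (d' ≫ biprod.inr⟦(1 : ℤ)⟧')) := by
    rw [hv]; exact oct.mem
  -- The connecting morphism in `hmem` is factored through Σ²X₁ ⊞ Y₄. The restriction of n along X₃
  -- ⟶ N is φ₃.
  obtain ⟨n, hn, hd⟩ := hmem.exists_homotopyCartesian (isDist_shift_biprod _ h₂')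
  have he : biprod.desc (-biprod.lift f₄ (-φ₄)) (biprod.lift 0 g₃) =
      biprod.desc (biprod.lift (-f₄) φ₄) (biprod.lift 0 g₃) := by ext <;> simp
  have hc₁ := oct.comm₁ =≫ n
  rw [Category.assoc, hn] at hc₁
  have hc₁l := biprod.inl ≫= hc₁
  have hc₁r := biprod.inr ≫= hc₁
  have hz := (hd.zero₁₂ =≫ biprod.snd)
  have hzl := (biprod.inl ≫ p) ≫= hz
  have hc₃ := biprod.inl ≫= oct.comm₃
  have hc₃r := biprod.inr ≫= oct.comm₃
  simp [biprod.lift_desc] at hc₁l hc₁r hzl hc₃ hc₃r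
  refine ⟨biprod.inl ≫ p ≫ n, φ₄, ?_, ?_, ?_, N, p, q, _, _, hN, he ▸ hd, ?_, ?_⟩
  · rw [← h₃, Category.assoc, ← hc₁l, reassoc_of% hφ₁, h₃']
  · rw [reassoc_of% hc₃, Preadditive.neg_comp] at hzl
    simpa using neg_add_eq_zero.1 hzl
  · rw [← h₄, Category.assoc, ← Functor.map_comp, hφ₂, Functor.map_comp, ← reassoc_of% hφ₄, h₄']
  · ext <;> simp [hc₃, hc₃r, ← hc₁r, h₃']
  · rw [Category.assoc, ← Functor.map_comp, oct.comm₂]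
    ext1 <;> simp [← Functor.map_comp, ← h₄']

end IsQuad

end Quad

/-! ### Transport of spliced sequences along a fully faithful functor -/

section

universe v' w'

/-- The comparison isomorphism between biproducts for an additive functor. -/
@[simps]
noncomputable def additiveBiprodIso {C : Type w} [Category.{v} C] [Preadditive C]
    [HasBinaryBiproducts C] {F : Type w'} [Category.{v'} F] [Preadditive F] [HasBinaryBiproducts F]
    (G : F ⥤ C) [G.Additive] (A B : F) : G.obj A ⊞ G.obj B ≅ G.obj (A ⊞ B) where
  hom := biprod.desc (G.map biprod.inl) (G.map biprod.inr)
  inv := biprod.lift (G.map biprod.fst) (G.map biprod.snd)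
  hom_inv_id := by ext <;> simp [← Functor.map_comp]
  inv_hom_id := by
    rw [biprod.lift_desc, ← Functor.map_comp, ← Functor.map_comp, ← Functor.map_add, biprod.total,
      CategoryTheory.Functor.map_id]

end

section Standard

open Pretriangulated ZeroObject

universe v' w'

variable {C : Type w} [Category.{v} C] [Preadditive C] [HasZeroObject C] [HasShift C ℤ]
  [∀ n : ℤ, (shiftFunctor C n).Additive] [Pretriangulated C]
  {F : Type w'} [Category.{v'} F]

/-- The sequences in `F` whose images under `G : F ⥤ C` are spliced from two distinguished
triangles. -/
def standardFourAngles {S : F ⥤ F} {G : F ⥤ C}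
    (τ : S ⋙ G ≅ G ⋙ shiftFunctor C (1 : ℤ) ⋙ shiftFunctor C (1 : ℤ)) : Set (FourSeq S) :=
  {X | IsQuad (G.map X.α₁) (G.map X.α₂) (G.map X.α₃) (G.map X.α₄ ≫ τ.hom.app X.X₁)}

variable {S : F ⥤ F} {G : F ⥤ C}
  {τ : S ⋙ G ≅ G ⋙ shiftFunctor C (1 : ℤ) ⋙ shiftFunctor C (1 : ℤ)}

lemma mem_standardFourAngles_of_isomorphic {X Y : FourSeq S} (h : X.Isomorphic Y)
    (hX : X ∈ standardFourAngles τ) : Y ∈ standardFourAngles τ := by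
  obtain ⟨φ, h₁, h₂, h₃, h₄⟩ := h
  refine IsQuad.of_iso hX (asIso (G.map φ.φ₁)) (asIso (G.map φ.φ₂)) (asIso (G.map φ.φ₃))
    (asIso (G.map φ.φ₄)) ?_ ?_ ?_ ?_
  · simp [← Functor.map_comp, φ.comm₁]
  · simp [← Functor.map_comp, φ.comm₂]
  · simp [← Functor.map_comp, φ.comm₃]
  · have := τ.hom.naturality φ.φ₁
    dsimp at this ⊢
    rw [Category.assoc, ← this, ← Functor.map_comp_assoc, φ.comm₄, Functor.map_comp_assoc]

lemma FourSeq.Isomorphic.symm {X Y : FourSeq S} (h : X.Isomorphic Y) : Y.Isomorphic X := by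
  obtain ⟨φ, h₁, h₂, h₃, h₄⟩ := h
  refine ⟨⟨inv φ.φ₁, inv φ.φ₂, inv φ.φ₃, inv φ.φ₄, ?_, ?_, ?_, ?_⟩,
    ?_, ?_, ?_, ?_⟩
  · simp [← reassoc_of% φ.comm₁]
  · simp [← reassoc_of% φ.comm₂]
  · simp [← reassoc_of% φ.comm₃]
  · simp [← reassoc_of% φ.comm₄]
  all_goals dsimp; infer_instance

lemma rotate_mem_standardFourAngles_iff [IsTriangulated C] (X : FourSeq S) :
    X.rotate ∈ standardFourAngles τ ↔ X ∈ standardFourAngles τ := by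
  have hn := τ.hom.naturality X.α₁
  dsimp at hn
  constructor
  · intro h
    apply IsQuad.of_rotate
    refine IsQuad.of_iso h (Iso.refl _) (Iso.refl _) (Iso.refl _) (τ.app _) ?_ ?_ ?_ ?_
    all_goals simp [FourSeq.rotate, hn]
  · intro h
    refine (IsQuad.rotate h).of_iso (Iso.refl _) (Iso.refl _) (Iso.refl _) (τ.app _).symm ?_ ?_ ?_ ?_
    all_goals simp [FourSeq.rotate, hn]

variable [Preadditive F] [HasZeroObject F] [HasBinaryBiproducts F] [G.Additive]

omit [HasBinaryBiproducts F] in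
lemma trivial_mem_standardFourAngles (X : F) : FourSeq.trivial S X ∈ standardFourAngles τ := by
  have h₀ : IsZero (G.obj (FourSeq.trivial S X).X₃) := G.map_isZero (isZero_zero F)
  have h₀' : IsZero (G.obj (FourSeq.trivial S X).X₄) := G.map_isZero (isZero_zero F)
  refine ⟨G.obj (FourSeq.trivial S X).X₃, 0, 0, 𝟙 _, 0, ?_, ?_, h₀.eq_of_tgt _ _,
    h₀'.eq_of_src _ _⟩
  · refine (isDist_id (G.obj X)).of_iso (Iso.refl _) (Iso.refl _) ((isZero_zero C).iso h₀)
      (by simp [FourSeq.trivial]) (h₀.eq_of_tgt _ _) ((isZero_zero C).eq_of_src _ _)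
  · refine (isDist_id (G.obj (FourSeq.trivial S X).X₃)).of_iso (Iso.refl _) (Iso.refl _)
      ((isZero_zero C).iso h₀') (by simp) (h₀'.eq_of_tgt _ _) ((isZero_zero C).eq_of_src _ _)

omit [HasZeroObject F] in
lemma directSum_mem_standardFourAngles_iff (X Y : FourSeq S) :
    X.directSum Y ∈ standardFourAngles τ ↔
      IsQuad (biprod.map (G.map X.α₁) (G.map Y.α₁)) (biprod.map (G.map X.α₂) (G.map Y.α₂))
        (biprod.map (G.map X.α₃) (G.map Y.α₃))
        (biprod.desc ((G.map X.α₄ ≫ τ.hom.app X.X₁) ≫ biprod.inl⟦(1 : ℤ)⟧'⟦(1 : ℤ)⟧')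
          ((G.map Y.α₄ ≫ τ.hom.app Y.X₁) ≫ biprod.inr⟦(1 : ℤ)⟧'⟦(1 : ℤ)⟧')) := by
  have hn₁ := τ.hom.naturality (biprod.inl : X.X₁ ⟶ X.X₁ ⊞ Y.X₁)
  have hn₂ := τ.hom.naturality (biprod.inr : Y.X₁ ⟶ X.X₁ ⊞ Y.X₁)
  dsimp at hn₁ hn₂
  let e := additiveBiprodIso G
  have c₁ : biprod.map (G.map X.α₁) (G.map Y.α₁) ≫ (e _ _).hom =
      (e _ _).hom ≫ G.map (biprod.map X.α₁ Y.α₁) := by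
    ext <;> simp [e, ← Functor.map_comp]
  have c₂ : biprod.map (G.map X.α₂) (G.map Y.α₂) ≫ (e _ _).hom =
      (e _ _).hom ≫ G.map (biprod.map X.α₂ Y.α₂) := by
    ext <;> simp [e, ← Functor.map_comp]
  have c₃ : biprod.map (G.map X.α₃) (G.map Y.α₃) ≫ (e _ _).hom =
      (e _ _).hom ≫ G.map (biprod.map X.α₃ Y.α₃) := by
    ext <;> simp [e, ← Functor.map_comp]
  have c₄ : biprod.desc ((G.map X.α₄ ≫ τ.hom.app X.X₁) ≫ biprod.inl⟦(1 : ℤ)⟧'⟦(1 : ℤ)⟧')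
      ((G.map Y.α₄ ≫ τ.hom.app Y.X₁) ≫ biprod.inr⟦(1 : ℤ)⟧'⟦(1 : ℤ)⟧') ≫
      (e _ _).hom⟦(1 : ℤ)⟧'⟦(1 : ℤ)⟧' = (e _ _).hom ≫ G.map (X.directSum Y).α₄ ≫
        τ.hom.app (X.directSum Y).X₁ := by
    ext1
    · simp only [biprod.inl_desc_assoc, Category.assoc, ← Functor.map_comp, e, 
        additiveBiprodIso_hom, biprod.inl_desc, FourSeq.directSum, ← hn₁, ← Functor.map_comp_assoc]
    · simp only [biprod.inr_desc_assoc, Category.assoc, ← Functor.map_comp, e, 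
        additiveBiprodIso_hom, biprod.inr_desc, FourSeq.directSum, ← hn₂, ← Functor.map_comp_assoc]
  have inv_comm : ∀ {A B A' B' : C} (x : A ≅ A') (y : B ≅ B') (f : A ⟶ B) (g : A' ⟶ B'),
      f ≫ y.hom = x.hom ≫ g → g ≫ y.symm.hom = x.symm.hom ≫ f := by
    intro A B A' B' x y f g h
    rw [Iso.symm_hom, Iso.symm_hom, Iso.comp_inv_eq, Category.assoc, h, Iso.inv_hom_id_assoc]
  constructor
  · intro h
    exact IsQuad.of_iso h (e _ _).symm (e _ _).symm (e _ _).symm (e _ _).symm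
      (inv_comm _ _ _ _ c₁) (inv_comm _ _ _ _ c₂) (inv_comm _ _ _ _ c₃)
      (inv_comm _ ((shiftFunctor C (1 : ℤ)).mapIso ((shiftFunctor C (1 : ℤ)).mapIso (e _ _)))
        _ _ c₄)
  · intro h
    exact h.of_iso (e _ _) (e _ _) (e _ _) (e _ _) c₁ c₂ c₃ c₄

omit [HasZeroObject F] in
lemma exists_cone_mem_standardFourAngles [IsTriangulated C] [G.Full] [G.Faithful]
    (hv : ∀ (A B : F) (f : G.obj A ⟶ (G.obj B)⟦(1 : ℤ)⟧), f = 0) (X : FourSeq S)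
    (hX : X ∈ standardFourAngles τ) (Y : FourSeq S) (hY : Y ∈ standardFourAngles τ)
    (φ₁ : X.X₁ ⟶ Y.X₁) (φ₂ : X.X₂ ⟶ Y.X₂) (h : X.α₁ ≫ φ₂ = φ₁ ≫ Y.α₁) :
    ∃ φ : FourSeq.Hom X Y, φ.φ₁ = φ₁ ∧ φ.φ₂ = φ₂ ∧ FourSeq.cone φ ∈ standardFourAngles τ := by
  obtain ⟨φ₃, φ₄, c₂, c₃, c₄, hc⟩ := IsQuad.exists_cone hX hY (hv _ _)
    (G.map φ₁) (G.map φ₂) (by simp [← Functor.map_comp, h])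
  obtain ⟨φ₃, rfl⟩ := G.map_surjective φ₃
  obtain ⟨φ₄, rfl⟩ := G.map_surjective φ₄
  have hn := τ.hom.naturality φ₁
  have hn₁ := fun A B => τ.hom.naturality (biprod.inl : A ⟶ A ⊞ B)
  have hn₂ := fun A B => τ.hom.naturality (biprod.inr : B ⟶ A ⊞ B)
  have hn₃ := τ.hom.naturality X.α₁
  dsimp at hn hn₁ hn₂ hn₃
  have hl : ∀ A B : F, (biprod.inl : G.obj A ⟶ G.obj A ⊞ G.obj B)⟦(1 : ℤ)⟧'⟦(1 : ℤ)⟧' ≫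
      (biprod.desc (G.map biprod.inl) (G.map biprod.inr) :
        G.obj A ⊞ G.obj B ⟶ G.obj (A ⊞ B))⟦(1 : ℤ)⟧'⟦(1 : ℤ)⟧' =
      (G.map biprod.inl)⟦(1 : ℤ)⟧'⟦(1 : ℤ)⟧' := by
    simp [← Functor.map_comp]
  have hr : ∀ A B : F, (biprod.inr : G.obj B ⟶ G.obj A ⊞ G.obj B)⟦(1 : ℤ)⟧'⟦(1 : ℤ)⟧' ≫
      (biprod.desc (G.map biprod.inl) (G.map biprod.inr) :
        G.obj A ⊞ G.obj B ⟶ G.obj (A ⊞ B))⟦(1 : ℤ)⟧'⟦(1 : ℤ)⟧' =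
      (G.map biprod.inr)⟦(1 : ℤ)⟧'⟦(1 : ℤ)⟧' := by
    simp [← Functor.map_comp]
  refine ⟨⟨φ₁, φ₂, φ₃, φ₄, h, G.map_injective (by simpa using c₂),
    G.map_injective (by simpa using c₃), G.map_injective ?_⟩, rfl, rfl, ?_⟩
  · rw [← cancel_mono (τ.hom.app _)]
    simpa [hn] using c₄
  -- The fourth object of the cone contains the image of S X₁ instead of Σ² of the image of X₁,
  -- hence the correction by τ.
  · refine hc.of_iso (additiveBiprodIso G _ _) (additiveBiprodIso G _ _) (additiveBiprodIso G _ _)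
      ((biprod.mapIso (τ.app _).symm (Iso.refl _)) ≪≫ (additiveBiprodIso G _ _)) ?_ ?_ ?_ ?_
    · ext1 <;> simp [FourSeq.cone, ← Functor.map_comp, biprod.lift_eq]
    · ext1 <;> simp [FourSeq.cone, ← Functor.map_comp, biprod.lift_eq]
    · ext1
      · simp only [biprod.inl_desc_assoc]
        simp [FourSeq.cone, biprod.lift_eq]
        simp [← Functor.map_comp]
      · simp [FourSeq.cone, biprod.lift_eq]
        simp [← Functor.map_comp]
    · ext1
      · simp [FourSeq.cone]
        rw [hl, hr, ← Functor.map_comp_assoc, biprod.inl_desc]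
        simp [hn₁, hn₂, reassoc_of% hn, reassoc_of% hn₃]
      · simp [FourSeq.cone]
        rw [← Functor.map_comp, ← Functor.map_comp, biprod.inr_desc, ← Functor.map_comp_assoc,
          biprod.inr_desc, Functor.map_comp_assoc, hn₂]

/-- Approximations give existence of 4-angles, and Hom(P, ΣP) = 0 gives the cone axiom. The
vanishing `hP'` of Hom(ΣP, P) enters only for direct summands. -/
theorem isFourAngulation_standardFourAngles [IsTriangulated C] [S.IsEquivalence] [G.Full]
    [G.Faithful] (P : ObjectProperty C) (hG : ∀ A, P (G.obj A))
    (hG' : ∀ X, P X → ∃ A, Nonempty (G.obj A ≅ X))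
    (happ : ∀ X : C, ∃ (M : C) (i : X ⟶ M), P M ∧
      ∀ (N : C) (f : X ⟶ N), P N → ∃ g : M ⟶ N, i ≫ g = f)
    (hP : ∀ X : C, P X ↔ ∀ N : C, P N → ∀ f : X ⟶ N⟦(1 : ℤ)⟧, f = 0)
    (hP' : ∀ X Y : C, P X → P Y → ∀ f : X⟦(1 : ℤ)⟧ ⟶ Y, f = 0) :
    IsFourAngulation S (standardFourAngles τ) where
  directSum_mem X Y Z e hX hY := mem_standardFourAngles_of_isomorphic e
    ((directSum_mem_standardFourAngles_iff X Y).2 (IsQuad.biprod hX hY))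
  summand_mem X Y Z e hZ :=
    ((directSum_mem_standardFourAngles_iff X Y).1
      (mem_standardFourAngles_of_isomorphic e.symm hZ)).of_biprod_left
      (hP' _ _ (hG _) (hG _)) (hP' _ _ (hG _) (hG _)) ((hP _).1 (hG _) _ (hG _))
      ((hP _).1 (hG _) _ (hG _))
  trivial_mem := trivial_mem_standardFourAngles
  exists_mem {X₁ X₂} α₁ := by
    obtain ⟨Y₃, Y₄, f₂, f₃, f₄, h₃, h₄, h⟩ := IsQuad.exists_of_approximation P happ hP (G.map α₁)
    obtain ⟨X₃, ⟨e₃⟩⟩ := hG' _ h₃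
    obtain ⟨X₄, ⟨e₄⟩⟩ := hG' _ h₄
    refine ⟨X₃, X₄, G.preimage (f₂ ≫ e₃.inv), G.preimage (e₃.hom ≫ f₃ ≫ e₄.inv),
      G.preimage (e₄.hom ≫ f₄ ≫ τ.inv.app X₁), ?_⟩
    refine h.of_iso (Iso.refl _) (Iso.refl _) e₃.symm e₄.symm ?_ ?_ ?_ ?_
    all_goals simp
  rotate_mem_iff := rotate_mem_standardFourAngles_iff
  exists_hom X hX Y hY φ₁ φ₂ h := by
    obtain ⟨φ, h₁, h₂, _⟩ := (exists_cone_mem_standardFourAngles fun _ _ => (hP _).1 (hG _) _ (hG _)) X hX Y hY φ₁ φ₂ h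
    exact ⟨φ, h₁, h₂⟩
  exists_hom_cone_mem := (exists_cone_mem_standardFourAngles fun _ _ => (hP _).1 (hG _) _ (hG _))

end Standard

/-! ### The right module `Hom(T, X)` over the endomorphism ring of `T` -/

section HomModule

variable {k : Type u} [Field k] {C : Type w} [Category.{v} C] [Preadditive C] [Linear k C]
  {Λ : Type u} [Ring Λ] [Algebra k Λ] {T : C} (e : Λ ≃ₐ[k] End T)

/-- The morphisms `T ⟶ X`, considered as a right module over `Λ ≅ End T`. -/
def HomModule (_ : Λ ≃ₐ[k] End T) (X : C) : Type v := T ⟶ X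

namespace HomModule

/-- The element of `HomModule e X` given by a morphism. -/
def of {X : C} (f : T ⟶ X) : HomModule e X := f

variable {e}

/-- The morphism underlying an element of `HomModule e X`. -/
def hom {X : C} (f : HomModule e X) : T ⟶ X := f

@[ext] lemma ext {X : C} {f g : HomModule e X} (h : f.hom = g.hom) : f = g := h

@[simp] lemma hom_of {X : C} (f : T ⟶ X) : (of e f).hom = f := rfl

@[simp] lemma of_hom {X : C} (f : HomModule e X) : of e f.hom = f := rfl

instance (X : C) : AddCommGroup (HomModule e X) := inferInstanceAs (AddCommGroup (T ⟶ X))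

@[simp] lemma hom_add {X : C} (f g : HomModule e X) : (f + g).hom = f.hom + g.hom := rfl

@[simp] lemma hom_sum {X : C} {ι : Type*} (s : Finset ι) (f : ι → HomModule e X) :
    (∑ j ∈ s, f j).hom = ∑ j ∈ s, (f j).hom := rfl

lemma map_mul (a b : Λ) : e (a * b) = e b ≫ e a := _root_.map_mul e a b

instance (X : C) : Module Λᵐᵒᵖ (HomModule e X) where
  smul a f := of e ((e a.unop : T ⟶ T) ≫ f.hom)
  one_smul f := by
    refine HomModule.ext ?_
    change (e 1 : T ⟶ T) ≫ f.hom = f.hom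
    rw [map_one, End.one_def, Category.id_comp]
  mul_smul a b f := by
    refine HomModule.ext ?_
    change (e (b.unop * a.unop) : T ⟶ T) ≫ f.hom = e a.unop ≫ e b.unop ≫ f.hom
    rw [map_mul, Category.assoc]
  smul_zero a := HomModule.ext comp_zero
  smul_add a f g := HomModule.ext (Preadditive.comp_add _ _ _ _ _ _)
  add_smul a b f := by
    refine HomModule.ext ?_
    change (e (a.unop + b.unop) : T ⟶ T) ≫ f.hom = _
    rw [map_add]
    exact Preadditive.add_comp _ _ _ _ _ _
  zero_smul f := by
    refine HomModule.ext ?_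
    change (e 0 : T ⟶ T) ≫ f.hom = 0
    rw [map_zero]
    exact zero_comp

@[simp] lemma hom_smul {X : C} (a : Λᵐᵒᵖ) (f : HomModule e X) :
    (a • f).hom = (e a.unop : T ⟶ T) ≫ f.hom := rfl

variable (e) in
/-- Composition with a morphism `X ⟶ Y`. -/
def map {X Y : C} (f : X ⟶ Y) : HomModule e X →ₗ[Λᵐᵒᵖ] HomModule e Y where
  toFun t := of e (t.hom ≫ f)
  map_add' _ _ := HomModule.ext (Preadditive.add_comp _ _ _ _ _ _)
  map_smul' _ _ := HomModule.ext (Category.assoc _ _ _)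

@[simp] lemma hom_map {X Y : C} (f : X ⟶ Y) (t : HomModule e X) :
    (map e f t).hom = t.hom ≫ f := rfl

/-- A linear map on `Hom(T, X)` commutes with composition with endomorphisms of `T`. -/
lemma hom_apply_comp {X Y : C} (ψ : HomModule e X →ₗ[Λᵐᵒᵖ] HomModule e Y) (s : T ⟶ T)
    (t : T ⟶ X) : (ψ (of e (s ≫ t))).hom = s ≫ (ψ (of e t)).hom := by
  have := congrArg hom (ψ.map_smul (op (e.symm s)) (of e t))
  have h : (e (e.symm s) : T ⟶ T) = s := e.apply_symm_apply s
  simp only [hom_smul, unop_op, h] at this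
  rw [← this]
  congr 2
  refine HomModule.ext ?_
  simp [h]

variable (e) in
/-- The regular module is `Hom(T, T)`. -/
def regular : Λ ≃ₗ[Λᵐᵒᵖ] HomModule e T where
  toFun a := of e (e a)
  invFun f := e.symm f.hom
  left_inv a := e.symm_apply_apply a
  right_inv f := e.apply_symm_apply f.hom
  map_add' a b := map_add e a b
  map_smul' a b := map_mul b a.unop

@[simp] lemma hom_regular (a : Λ) : (regular e a).hom = e a := rfl
@[simp] lemma regular_symm_apply (f : HomModule e T) : (regular e).symm f = e.symm f.hom := rfl

end HomModule

/-- The regular right module, as a module over the opposite ring. -/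
def unopLinearEquiv (Λ : Type u) [Ring Λ] : Λᵐᵒᵖ ≃ₗ[Λᵐᵒᵖ] Λ :=
  { opAddEquiv.symm with map_smul' := fun _ _ => rfl }

instance (Λ : Type u) [Ring Λ] : Module.Finite Λᵐᵒᵖ Λ := Module.Finite.equiv (unopLinearEquiv Λ)

instance (Λ : Type u) [Ring Λ] : Module.Free Λᵐᵒᵖ Λ :=
  Module.Free.of_equiv (unopLinearEquiv Λ)

/-! ### Objects of `add T` in coordinates -/

/-- A presentation of `X` as a retract of `T ^ n`. -/
structure RetractData (T X : C) where
  n : ℕ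
  p : Fin n → (X ⟶ T)
  i : Fin n → (T ⟶ X)
  sum_eq : ∑ j, p j ≫ i j = 𝟙 X

lemma RetractData.hom_eq {X : C} (r : RetractData T X) {Y : C} (f : X ⟶ Y) :
    f = ∑ j, r.p j ≫ r.i j ≫ f := by
  conv_lhs => rw [← Category.id_comp f, ← r.sum_eq, Preadditive.sum_comp]
  simp

lemma RetractData.hom_eq' {X : C} (r : RetractData T X) {Y : C} (f : Y ⟶ X) :
    f = ∑ j, (f ≫ r.p j) ≫ r.i j := by
  conv_lhs => rw [← Category.comp_id f, ← r.sum_eq, Preadditive.comp_sum]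
  simp

lemma addProperty.exists_retractData [HasBinaryBiproducts C] [HasFiniteBiproducts C] {X : C}
    (h : addProperty T X) : Nonempty (RetractData T X) := by
  obtain ⟨n, Y, ⟨i⟩⟩ := h
  refine ⟨⟨n, fun j => biprod.inl ≫ i.hom ≫ biproduct.π _ j,
    fun j => biproduct.ι (fun _ : Fin n => T) j ≫ i.inv ≫ biprod.fst, ?_⟩⟩
  have h := biproduct.total (f := fun _ : Fin n => T)
  have : biprod.inl ≫ i.hom ≫ (∑ j, biproduct.π (fun _ : Fin n => T) j ≫
      biproduct.ι (fun _ : Fin n => T) j) ≫ i.inv ≫ biprod.fst = 𝟙 X := by rw [h]; simp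
  simpa only [Preadditive.sum_comp, Preadditive.comp_sum, Category.assoc] using this

lemma addProperty_self [HasBinaryBiproducts C] [HasFiniteBiproducts C] : addProperty T T := by
  refine ⟨1, ⨁ fun _ : Fin 0 => T, ⟨?_⟩⟩
  have h0 : IsZero (⨁ fun _ : Fin 0 => T) := by
    rw [IsZero.iff_id_eq_zero]
    exact biproduct.hom_ext _ _ fun j => j.elim0
  refine ⟨biprod.fst ≫ biproduct.ι (fun _ : Fin 1 => T) 0, biproduct.π _ 0 ≫ biprod.inl, ?_, ?_⟩
  · refine biprod.hom_ext' _ _ ?_ (h0.eq_of_src _ _)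
    refine biprod.hom_ext _ _ ?_ (h0.eq_of_tgt _ _)
    simp
  · have := biproduct.total (f := fun _ : Fin 1 => T)
    simpa using this

namespace RetractData

open HomModule

variable {e} {X : C} (r : RetractData T X)
include r

lemma hom_ext {Y : C} {f g : X ⟶ Y} (h : ∀ t : T ⟶ X, t ≫ f = t ≫ g) : f = g := by
  rw [r.hom_eq f, r.hom_eq g]
  simp only [h]

lemma map_injective {Y : C} : Function.Injective (HomModule.map e (X := X) (Y := Y)) :=
  fun _ _ h => r.hom_ext fun t => congrArg hom (DFunLike.congr_fun h (of e t))

/-- The identity of X is the sum of the p j ≫ i j, so linearity forces ψ to be composition with the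
sum of the p j ≫ ψ(i j). -/
lemma map_surjective {Y : C} : Function.Surjective (HomModule.map e (X := X) (Y := Y)) := by
  intro ψ
  refine ⟨∑ j, r.p j ≫ (ψ (of e (r.i j))).hom, LinearMap.ext fun t => HomModule.ext ?_⟩
  rw [hom_map, Preadditive.comp_sum]
  conv_rhs => rw [← of_hom t, r.hom_eq' t.hom]
  have : of e (∑ j, (t.hom ≫ r.p j) ≫ r.i j) = ∑ j, of e ((t.hom ≫ r.p j) ≫ r.i j) := rfl
  rw [this, map_sum, hom_sum]
  exact Finset.sum_congr rfl fun j _ => by rw [hom_apply_comp, Category.assoc]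

variable (e) in
/-- The coordinates of `t : T ⟶ X` with respect to a retract datum. -/
def coord : HomModule e X →ₗ[Λᵐᵒᵖ] (Fin r.n → Λ) :=
  LinearMap.pi fun j => (regular e).symm.toLinearMap ∘ₗ HomModule.map e (r.p j)

variable (e) in
/-- The morphism `T ⟶ X` with given coordinates. -/
def ofCoord : (Fin r.n → Λ) →ₗ[Λᵐᵒᵖ] HomModule e X :=
  ∑ j, HomModule.map e (r.i j) ∘ₗ (regular e).toLinearMap ∘ₗ LinearMap.proj j

lemma apply_coord (t : HomModule e X) (j : Fin r.n) :
    (e (r.coord e t j) : T ⟶ T) = t.hom ≫ r.p j :=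
  e.apply_symm_apply _

lemma hom_ofCoord (a : Fin r.n → Λ) :
    (r.ofCoord e a).hom = ∑ j, (e (a j) : T ⟶ T) ≫ r.i j := by
  rw [ofCoord, LinearMap.sum_apply, hom_sum]
  rfl

lemma ofCoord_comp_coord : r.ofCoord e ∘ₗ r.coord e = LinearMap.id := by
  refine LinearMap.ext fun t => HomModule.ext ?_
  rw [LinearMap.comp_apply, hom_ofCoord]
  simp only [apply_coord]
  exact (r.hom_eq' t.hom).symm

lemma finite_homModule : Module.Finite Λᵐᵒᵖ (HomModule e X) :=
  Module.Finite.of_surjective (r.ofCoord e)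
    (LinearMap.surjective_of_comp_eq_id _ _ r.ofCoord_comp_coord)

lemma projective_homModule : Module.Projective Λᵐᵒᵖ (HomModule e X) :=
  Module.Projective.of_split (r.coord e) (r.ofCoord e) r.ofCoord_comp_coord

end RetractData

end HomModule

/-! ### Realization of projective modules, and fullness of `Hom(T, -)` -/

section Realization

variable {k : Type u} [Field k] {C : Type w} [Category.{v} C] [Preadditive C] [Linear k C]
  {Λ : Type u} [Ring Λ] [Algebra k Λ] {T : C} (e : Λ ≃ₐ[k] End T)

open HomModule

/-- A retract of an object with a retract datum has a retract datum. -/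
def RetractData.ofRetract {X Y : C} (r : RetractData T X) (i : Y ⟶ X) (p : X ⟶ Y)
    (h : i ≫ p = 𝟙 Y) : RetractData T Y where
  n := r.n
  p j := i ≫ r.p j
  i j := r.i j ≫ p
  sum_eq := by
    have : i ≫ (∑ j, r.p j ≫ r.i j) ≫ p = 𝟙 Y := by rw [r.sum_eq, Category.id_comp, h]
    simpa only [Preadditive.sum_comp, Preadditive.comp_sum, Category.assoc] using this

/-- The finite direct sum of copies of `T` as a retract of itself. -/
noncomputable def RetractData.biproduct (T : C) (n : ℕ) [HasFiniteBiproducts C] :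
    RetractData T (⨁ fun _ : Fin n => T) where
  n := n
  p := biproduct.π _
  i := biproduct.ι _
  sum_eq := biproduct.total

/-- Morphisms `T ⟶ T ^ n` correspond to vectors over `Λ`. -/
noncomputable def HomModule.biproductEquiv (n : ℕ) [HasFiniteBiproducts C] :
    HomModule e (⨁ fun _ : Fin n => T) ≃ₗ[Λᵐᵒᵖ] (Fin n → Λ) :=
  LinearEquiv.ofLinearMap ((RetractData.biproduct T n).coord e)
    ((RetractData.biproduct T n).ofCoord e)
    (LinearMap.ext fun a => funext fun j => e.injective <| by
      have : (∑ l, (e (a l) : T ⟶ T) ≫ biproduct.ι (fun _ : Fin n => T) l) ≫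
          biproduct.π (fun _ : Fin n => T) j = e (a j) := by
        rw [Preadditive.sum_comp, Finset.sum_eq_single j]
        · simp
        · intro l _ hl
          simp [biproduct.ι_π_ne _ hl]
        · simp
      refine (RetractData.apply_coord _ _ _).trans (Eq.trans ?_ this)
      exact congrArg (· ≫ biproduct.π (fun _ : Fin n => T) j)
        ((RetractData.biproduct T n).hom_ofCoord (e := e) a))
    (RetractData.ofCoord_comp_coord _)

variable {e} in
lemma HomModule.map_id (X : C) : HomModule.map e (𝟙 X) = LinearMap.id :=
  LinearMap.ext fun _ => HomModule.ext (Category.comp_id _)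

variable {e} in
lemma HomModule.map_comp {X Y Z : C} (f : X ⟶ Y) (g : Y ⟶ Z) :
    HomModule.map e (f ≫ g) = HomModule.map e g ∘ₗ HomModule.map e f :=
  LinearMap.ext fun _ => HomModule.ext (Category.assoc _ _ _).symm

/-- Finitely generated projective modules are of the form `Hom(T, X)` with `X` a retract of a
finite direct sum of copies of `T`. -/
lemma exists_homModule_equiv [HasFiniteBiproducts C] [IsIdempotentComplete C] (M : Type u)
    [AddCommGroup M] [Module Λᵐᵒᵖ M] [Module.Finite Λᵐᵒᵖ M] [Module.Projective Λᵐᵒᵖ M] :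
    ∃ X : C, Nonempty (RetractData T X) ∧ Nonempty (M ≃ₗ[Λᵐᵒᵖ] HomModule e X) := by
  obtain ⟨n, b', hb'⟩ := Module.Finite.exists_fin' Λᵐᵒᵖ M
  obtain ⟨s', hs'⟩ := Module.projective_lifting_property b' LinearMap.id hb'
  let u := LinearEquiv.piCongrRight fun _ : Fin n => unopLinearEquiv Λ
  let b : (Fin n → Λ) →ₗ[Λᵐᵒᵖ] M := b' ∘ₗ u.symm.toLinearMap
  let s : M →ₗ[Λᵐᵒᵖ] (Fin n → Λ) := u.toLinearMap ∘ₗ s'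
  have hbs : ∀ m, b (s m) = m := fun m => by
    simpa [b, s] using DFunLike.congr_fun hs' m
  let r := RetractData.biproduct T n
  let c := HomModule.biproductEquiv e n
  -- The idempotent s ∘ b of Λⁿ, whose image is M, becomes an idempotent E of Tⁿ; splitting E yields
  -- X.
  obtain ⟨E, hE⟩ := r.map_surjective
    (c.symm.toLinearMap ∘ₗ s ∘ₗ b ∘ₗ c.toLinearMap)
  have hE' : ∀ t, HomModule.map e E t = c.symm (s (b (c t))) := DFunLike.congr_fun hE
  have hEE : E ≫ E = E := r.map_injective (e := e) <| LinearMap.ext fun t => by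
    rw [HomModule.map_comp, LinearMap.comp_apply, hE', hE', c.apply_symm_apply, hbs]
  obtain ⟨X, i, p, hip, hpi⟩ := IsIdempotentComplete.idempotents_split _ E hEE
  have hp : ∀ t, HomModule.map e i (HomModule.map e p t) = HomModule.map e E t := fun t => by
    rw [← hpi, HomModule.map_comp]; rfl
  have hi : ∀ t, HomModule.map e p (HomModule.map e i t) = t := fun t => by
    rw [← LinearMap.comp_apply, ← HomModule.map_comp, hip, HomModule.map_id]; rfl
  refine ⟨X, ⟨r.ofRetract i p hip⟩, ⟨LinearEquiv.ofLinearMap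
    (HomModule.map e p ∘ₗ c.symm.toLinearMap ∘ₗ s) (b ∘ₗ c.toLinearMap ∘ₗ HomModule.map e i)
    (LinearMap.ext fun t => ?_) (LinearMap.ext fun m => ?_)⟩⟩
  · simp only [LinearMap.comp_apply, LinearMap.id_apply, LinearEquiv.coe_coe]
    rw [← hE', ← hp, hi, hi]
  · simp only [LinearMap.comp_apply, LinearMap.id_apply, LinearEquiv.coe_coe]
    rw [hp, hE', c.apply_symm_apply, c.apply_symm_apply, hbs, hbs]

end Realization

/-! ### Cluster tilting objects and fullness of Hom(T, -) on the whole category -/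

section ClusterTilting

variable {C : Type w} [Category.{v} C] [Preadditive C] [HasShift C ℤ]

namespace IsClusterTilting

variable {P : ObjectProperty C} (hP : IsClusterTilting 2 P)
include hP

lemma iff_right (X : C) : P X ↔ ∀ M : C, P M → ∀ f : M ⟶ X⟦(1 : ℤ)⟧, f = 0 := by
  rw [hP.mem_iff_right]
  refine ⟨fun h M hM f => h 1 le_rfl one_lt_two M hM f, fun h i h₁ h₂ => ?_⟩
  obtain rfl : i = 1 := by omega
  exact h

lemma iff_left (X : C) : P X ↔ ∀ M : C, P M → ∀ f : X ⟶ M⟦(1 : ℤ)⟧, f = 0 := by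
  rw [hP.mem_iff_left]
  refine ⟨fun h M hM f => h 1 le_rfl one_lt_two M hM f, fun h i h₁ h₂ => ?_⟩
  obtain rfl : i = 1 := by omega
  exact h

lemma of_iso {X Y : C} (i : X ≅ Y) (hX : P X) : P Y := by
  refine (hP.iff_left Y).2 fun M hM f => ?_
  rw [← cancel_epi i.hom, (hP.iff_left X).1 hX M hM (i.hom ≫ f), comp_zero]

end IsClusterTilting

variable [∀ n : ℤ, (shiftFunctor C n).Additive] [HasBinaryBiproducts C]
  [HasFiniteBiproducts C] {T : C}

omit [∀ n : ℤ, (shiftFunctor C n).Additive] in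
lemma IsClusterTilting.eq_zero (hT : IsClusterTilting 2 (addProperty T)) {X Y : C}
    (hX : addProperty T X) (hY : addProperty T Y) (f : X ⟶ Y⟦(1 : ℤ)⟧) : f = 0 :=
  (hT.iff_left X).1 hX Y hY f

lemma IsClusterTilting.mem_iff_generator (hT : IsClusterTilting 2 (addProperty T)) (X : C) :
    addProperty T X ↔ ∀ f : X ⟶ T⟦(1 : ℤ)⟧, f = 0 := by
  refine ⟨fun h f => hT.eq_zero h addProperty_self f, fun h => (hT.iff_left X).2 fun M hM f => ?_⟩
  obtain ⟨r⟩ := hM.exists_retractData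
  have := congrArg (fun g => f ≫ g⟦(1 : ℤ)⟧') r.sum_eq
  simp only [CategoryTheory.Functor.map_id, Category.comp_id] at this
  rw [← this, Functor.map_sum, Preadditive.comp_sum]
  refine Finset.sum_eq_zero fun j _ => ?_
  rw [Functor.map_comp, ← Category.assoc, h (f ≫ _), zero_comp]

/-- No complement has to be constructed: membership in add T is tested by the vanishing of morphisms
to ΣT, which passes to retracts. -/
lemma RetractData.addProperty (hT : IsClusterTilting 2 (addProperty T)) {X : C}
    (r : RetractData T X) : addProperty T X := by
  refine (hT.mem_iff_generator X).2 fun f => ?_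
  rw [r.hom_eq f]
  refine Finset.sum_eq_zero fun j _ => ?_
  rw [hT.eq_zero addProperty_self addProperty_self (r.i j ≫ f), comp_zero]

/-- T₀ is a right approximation of X. A morphism M ⟶ ΣT₁ with M in add T dies in ΣT₀, so it comes
from M ⟶ X, which factors through T₀; hence it is zero and T₁ lies in add T. -/
lemma IsClusterTilting.exists_isDist [HasZeroObject C] [Pretriangulated C]
    (hT : IsClusterTilting 2 (_root_.addProperty T)) (X : C) :
    ∃ (T₁ T₀ : C) (a : T₁ ⟶ T₀) (π : T₀ ⟶ X) (b : X ⟶ T₁⟦(1 : ℤ)⟧), IsDist a π b ∧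
      _root_.addProperty T T₁ ∧ _root_.addProperty T T₀ ∧ ∀ t : T ⟶ X, ∃ s : T ⟶ T₀, s ≫ π = t := by
  obtain ⟨T₀, π, hT₀, hπ⟩ := hT.functoriallyFinite.1 X
  obtain ⟨T₁, a, b, h⟩ := Pretriangulated.distinguished_cocone_triangle₁ π
  have h : IsDist a π b := h
  refine ⟨T₁, T₀, a, π, b, h, (hT.iff_right T₁).2 fun M hM f => ?_, hT₀,
    fun t => hπ T t addProperty_self⟩
  obtain ⟨s, rfl⟩ := h.exists_lift₁ f (hT.eq_zero hM hT₀ _)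
  obtain ⟨s', rfl⟩ := hπ M s hM
  rw [Category.assoc, h.zero₂₃, comp_zero]

open HomModule in
-- In a triangle T₁ ⟶ T₀ ⟶ X with T₁, T₀ in add T, the linear map lifts to a morphism on T₀. It
-- kills T₁, which can be tested on morphisms from T, so it descends to X; surjectivity of Hom(T,
-- T₀) ⟶ Hom(T, X) shows that it induces ψ. Neither X nor Y has to lie in add T.
lemma IsClusterTilting.map_surjective [HasZeroObject C] [Pretriangulated C] {k : Type u}
    [Field k] [Linear k C] {Λ : Type u} [Ring Λ] [Algebra k Λ] (e : Λ ≃ₐ[k] End T)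
    (hT : IsClusterTilting 2 (_root_.addProperty T)) (X Y : C) :
    Function.Surjective (HomModule.map e (X := X) (Y := Y)) := by
  intro ψ
  obtain ⟨T₁, T₀, a, π, b, h, h₁, h₀, hπ⟩ := hT.exists_isDist X
  obtain ⟨r₁⟩ := h₁.exists_retractData
  obtain ⟨r₀⟩ := h₀.exists_retractData
  obtain ⟨f₀, hf₀⟩ := r₀.map_surjective (ψ ∘ₗ HomModule.map e π)
  have hf₀' : ∀ t : T ⟶ T₀, t ≫ f₀ = (ψ (of e (t ≫ π))).hom := fun t =>
    congrArg hom (DFunLike.congr_fun hf₀ (of e t))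
  obtain ⟨f, rfl⟩ := h.exists_desc₂ f₀ (r₁.hom_ext fun t => by
    rw [← Category.assoc, hf₀', Category.assoc, h.zero₁₂, comp_zero, comp_zero]
    exact congrArg hom (map_zero ψ))
  refine ⟨f, LinearMap.ext fun t => HomModule.ext ?_⟩
  obtain ⟨s, hs⟩ := hπ t.hom
  have := hf₀' s
  rw [hs, of_hom, ← Category.assoc, hs] at this
  exact this

end ClusterTilting

/-! ### Serre duality and selfinjectivity -/

section Selfinjective

variable {k : Type u} [Field k] {C : Type w} [Category.{v} C] [Preadditive C] [Linear k C]

/-- Serre duality only depends on the isomorphism class of the functor. -/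
noncomputable def SerreDuality.ofIso {S S' : C ⥤ C} (D : SerreDuality k S) (i : S ≅ S') :
    SerreDuality k S' where
  equiv X Y := Linear.homCongr k (Iso.refl X) (i.symm.app Y) ≪≫ₗ D.equiv X Y
  naturality {X X' Y Y'} f g h t := by
    have := D.naturality f g (h ≫ i.inv.app Y) t
    simpa [Linear.homCongr_apply] using this

/-- Every functional on Hom(Y, X) is dual to some f, and by naturality its value at t is the
functional dual to t ≫ f evaluated at the identity. -/
lemma SerreDuality.eq_zero {S : C ⥤ C} (D : SerreDuality k S) {X Y : C} (t : Y ⟶ X)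
    (h : ∀ f : X ⟶ S.obj Y, t ≫ f = 0) : t = 0 := by
  refine (Module.forall_dual_apply_eq_zero_iff k t).1 fun φ => ?_
  obtain ⟨f, rfl⟩ := (D.equiv X Y).surjective φ
  have := D.naturality t (𝟙 Y) f (𝟙 Y)
  simpa [h f] using this.symm

variable [HasShift C ℤ]

lemma IsWeaklyCalabiYau.exists_serreDuality (h : IsWeaklyCalabiYau k C 2) :
    Nonempty (SerreDuality k (shiftFunctor C (1 : ℤ) ⋙ shiftFunctor C (1 : ℤ))) := by
  obtain ⟨S, ⟨_, ⟨D⟩⟩, ⟨i⟩⟩ := h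
  exact ⟨D.ofIso (i ≪≫ shiftFunctorAdd' C 1 1 2 rfl)⟩

variable {Λ : Type u} [Ring Λ] [Algebra k Λ] {T : C} (e : Λ ≃ₐ[k] End T)
  [∀ n : ℤ, (shiftFunctor C n).Additive]

lemma shift_shift_hom_eq_zero {X Y : C} (h : ∀ f : X ⟶ Y, f = 0)
    (f : X⟦(1 : ℤ)⟧⟦(1 : ℤ)⟧ ⟶ Y⟦(1 : ℤ)⟧⟦(1 : ℤ)⟧) : f = 0 := by
  obtain ⟨f, rfl⟩ := (shiftFunctor C (1 : ℤ)).map_surjective f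
  obtain ⟨f, rfl⟩ := (shiftFunctor C (1 : ℤ)).map_surjective f
  rw [h f, Functor.map_zero, Functor.map_zero]

variable [HasZeroObject C] [Pretriangulated C]

include e in

/-- If `End T` is selfinjective, then `T` is a retract of a finite direct sum of copies of
`S T`, where `S` is the Serre functor. -/
lemma exists_retractData_serre (hfin : ∀ X Y : C, Module.Finite k (X ⟶ Y)) {S : C ⥤ C}
    (D : SerreDuality k S) (hT : IsClusterTilting 2 (addProperty T)) (hΛ : IsSelfinjective Λ) :
    Nonempty (RetractData (S.obj T) T) := by
  obtain ⟨n, f, hf⟩ := Module.Finite.exists_fin (R := k) (M := (T ⟶ S.obj T))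
  let j : T ⟶ ⨁ fun _ : Fin n => S.obj T := biproduct.lift f
  have hj : Function.Injective (HomModule.map e j) := by
    rw [← LinearMap.ker_eq_bot, LinearMap.ker_eq_bot']
    intro t ht
    refine HomModule.ext (D.eq_zero _ fun g => ?_)
    have ht' : t.hom ≫ j = 0 := congrArg HomModule.hom ht
    have hg : g ∈ Submodule.span k (Set.range f) := hf ▸ Submodule.mem_top
    induction hg using Submodule.span_induction with
    | mem x hx =>
      obtain ⟨i, rfl⟩ := hx
      have : f i = j ≫ biproduct.π _ i := by simp [j]
      rw [this, ← Category.assoc, ht', zero_comp]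
    | zero => exact comp_zero
    | add x y _ _ hx hy => rw [Preadditive.comp_add, hx, hy, add_zero]
    | smul a x _ hx => rw [Linear.comp_smul, hx, smul_zero]
  -- Injectivity of Λ retracts Hom(T, j). Since (𝕊T)ⁿ is not yet known to lie in add T, fullness on
  -- all of `C` is needed to realize the retraction.
  obtain ⟨h, hh⟩ := (Module.Baer.of_injective (Q := Λ) (R := Λᵐᵒᵖ) hΛ).extension_property
    (HomModule.map e j) hj (HomModule.regular e).symm.toLinearMap
  obtain ⟨ρ, hρ⟩ := hT.map_surjective e _ _ ((HomModule.regular e).toLinearMap ∘ₗ h)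
  have key : j ≫ ρ = 𝟙 T := by
    have h₁ : HomModule.map e ρ (HomModule.map e j (HomModule.of e (𝟙 T))) =
        HomModule.of e (𝟙 T) := by
      rw [hρ, LinearMap.comp_apply, ← LinearMap.comp_apply h, hh]
      exact (HomModule.regular e).apply_symm_apply _
    have h₂ := congrArg HomModule.hom h₁
    simpa using h₂
  refine ⟨⟨n, f, fun i => biproduct.ι (fun _ : Fin n => S.obj T) i ≫ ρ, ?_⟩⟩
  have : j ≫ (∑ i, biproduct.π (fun _ : Fin n => S.obj T) i ≫
      biproduct.ι (fun _ : Fin n => S.obj T) i) ≫ ρ = 𝟙 T := by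
    rw [biproduct.total, Category.id_comp, key]
  simpa only [Preadditive.sum_comp, Preadditive.comp_sum, Category.assoc, j,
    biproduct.lift_π_assoc] using this

namespace IsClusterTilting

variable (hT : IsClusterTilting 2 (addProperty T))
include hT

/-- By `r`, a morphism Σ²T ⟶ ΣT is determined by its composites to Σ³T, which vanish because Hom(T,
ΣT) = 0. -/
lemma addProperty_shift_shift
    (r : RetractData (T⟦(1 : ℤ)⟧⟦(1 : ℤ)⟧) T) {X : C} (hX : addProperty T X) :
    addProperty T (X⟦(1 : ℤ)⟧⟦(1 : ℤ)⟧) := by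
  refine (hT.mem_iff_generator _).2 fun f => ?_
  obtain ⟨s⟩ := hX.exists_retractData
  have h : ∀ f : T⟦(1 : ℤ)⟧⟦(1 : ℤ)⟧ ⟶ T⟦(1 : ℤ)⟧, f = 0 := fun f => by
    have := congrArg (fun g => f ≫ g⟦(1 : ℤ)⟧') r.sum_eq
    simp only [CategoryTheory.Functor.map_id, Category.comp_id] at this
    rw [← this, Functor.map_sum, Preadditive.comp_sum]
    refine Finset.sum_eq_zero fun j _ => ?_
    rw [Functor.map_comp, ← Category.assoc]
    have h0 : f ≫ (r.p j)⟦(1 : ℤ)⟧' = 0 :=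
      shift_shift_hom_eq_zero (Y := T⟦(1 : ℤ)⟧)
        (hT.eq_zero addProperty_self addProperty_self) _
    rw [h0, zero_comp]
  have := congrArg (fun g => g⟦(1 : ℤ)⟧'⟦(1 : ℤ)⟧' ≫ f) s.sum_eq
  simp only [CategoryTheory.Functor.map_id, Category.id_comp] at this
  rw [← this, Functor.map_sum, Functor.map_sum, Preadditive.sum_comp]
  refine Finset.sum_eq_zero fun j _ => ?_
  rw [Functor.map_comp, Functor.map_comp, Category.assoc, h (_ ≫ f), comp_zero]

lemma of_addProperty_shift_shift
    (h : ∀ X, addProperty T X → addProperty T (X⟦(1 : ℤ)⟧⟦(1 : ℤ)⟧)) {Y : C}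
    (hY : addProperty T (Y⟦(1 : ℤ)⟧⟦(1 : ℤ)⟧)) : addProperty T Y := by
  refine (hT.iff_right _).2 fun M hM f => ?_
  refine (shiftFunctor C (1 : ℤ)).map_injective ((shiftFunctor C (1 : ℤ)).map_injective ?_)
  rw [Functor.map_zero, Functor.map_zero]
  exact hT.eq_zero (h M hM) hY _

lemma shift_hom_eq_zero
    (h : ∀ X, addProperty T X → addProperty T (X⟦(1 : ℤ)⟧⟦(1 : ℤ)⟧)) {X Y : C}
    (hX : addProperty T X) (hY : addProperty T Y) (f : X⟦(1 : ℤ)⟧ ⟶ Y) : f = 0 := by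
  refine (shiftFunctor C (1 : ℤ)).map_injective ?_
  rw [Functor.map_zero]
  exact hT.eq_zero (h X hX) hY _

end IsClusterTilting

end Selfinjective

/-! ### The embedding of `proj Λ` with image `add T` -/

section Realization

variable {k : Type u} [Field k] {C : Type w} [Category.{v} C] [Preadditive C] [Linear k C]
  {Λ : Type u} [Ring Λ] [Algebra k Λ] {T : C} (e : Λ ≃ₐ[k] End T)

namespace RetractData

/-- The morphism inducing a given linear map on `Hom(T, -)`. -/
noncomputable def lift {X Y : C} (r : RetractData T X)
    (ψ : HomModule e X →ₗ[Λᵐᵒᵖ] HomModule e Y) : X ⟶ Y :=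
  (r.map_surjective ψ).choose

variable {e}

@[simp] lemma map_lift {X Y : C} (r : RetractData T X)
    (ψ : HomModule e X →ₗ[Λᵐᵒᵖ] HomModule e Y) : HomModule.map e (r.lift e ψ) = ψ :=
  (r.map_surjective ψ).choose_spec

/-- The isomorphism inducing a given linear equivalence on `Hom(T, -)`. -/
noncomputable def isoOfEquiv {X Y : C} (r : RetractData T X) (s : RetractData T Y)
    (ψ : HomModule e X ≃ₗ[Λᵐᵒᵖ] HomModule e Y) : X ≅ Y where
  hom := r.lift e ψ.toLinearMap
  inv := s.lift e ψ.symm.toLinearMap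
  hom_inv_id := r.map_injective (e := e) <| by
    rw [HomModule.map_comp, map_lift, map_lift, HomModule.map_id]
    exact LinearMap.ext ψ.symm_apply_apply
  inv_hom_id := s.map_injective (e := e) <| by
    rw [HomModule.map_comp, map_lift, map_lift, HomModule.map_id]
    exact LinearMap.ext ψ.apply_symm_apply

end RetractData

variable [HasFiniteBiproducts C] [IsIdempotentComplete C]

lemma FGProj.exists_homModule_equiv (M : FGProj Λ) :
    ∃ X : C, Nonempty (RetractData T X) ∧ Nonempty (M.obj ≃ₗ[Λᵐᵒᵖ] HomModule e X) :=
  have := M.property.1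
  have := M.property.2
  _root_.exists_homModule_equiv e M.obj

namespace Realization

/-- An object `X` with `Hom(T, X) ≅ M`. -/
noncomputable def obj (M : FGProj Λ) : C := (M.exists_homModule_equiv e).choose

/-- The object realizing a projective module is a retract of a direct sum of copies of `T`. -/
noncomputable def retractData (M : FGProj Λ) : RetractData T (obj e M) :=
  (M.exists_homModule_equiv e).choose_spec.1.some

/-- The isomorphism `M ≅ Hom(T, X)`. -/
noncomputable def equiv (M : FGProj Λ) : M.obj ≃ₗ[Λᵐᵒᵖ] HomModule e (obj e M) :=
  (M.exists_homModule_equiv e).choose_spec.2.some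

/-- The morphism realizing a linear map. -/
noncomputable def map {M N : FGProj Λ} (f : M ⟶ N) : obj e M ⟶ obj e N :=
  (retractData e M).lift e
    ((equiv e N).toLinearMap ∘ₗ f.hom.hom ∘ₗ (equiv e M).symm.toLinearMap)

lemma map_map {M N : FGProj Λ} (f : M ⟶ N) :
    HomModule.map e (map e f) =
      (equiv e N).toLinearMap ∘ₗ f.hom.hom ∘ₗ (equiv e M).symm.toLinearMap :=
  (retractData e M).map_lift _

lemma map_map_apply {M N : FGProj Λ} (f : M ⟶ N) (x : M.obj) :
    HomModule.map e (map e f) (equiv e M x) = equiv e N (f.hom.hom x) := by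
  rw [map_map]
  simp

lemma hom_map_apply {M N : FGProj Λ} (f : M ⟶ N) (x : M.obj) :
    (equiv e N (f.hom.hom x)).hom = (equiv e M x).hom ≫ map e f :=
  (congrArg HomModule.hom (map_map_apply e f x)).symm

lemma hom_ext {M : FGProj Λ} {Y : C} {f g : obj e M ⟶ Y}
    (h : ∀ x, (equiv e M x).hom ≫ f = (equiv e M x).hom ≫ g) : f = g :=
  (retractData e M).hom_ext fun t => by
    simpa using h ((equiv e M).symm (HomModule.of e t))

/-- The functor `proj Λ ⥤ C` which is quasi-inverse to `Hom(T, -) : add T ⥤ proj Λ`. -/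
noncomputable def functor : FGProj Λ ⥤ C where
  obj := obj e
  map := map e
  map_id M := hom_ext e fun x => by
    rw [← hom_map_apply, Category.comp_id]
    rfl
  map_comp f g := hom_ext e fun x => by
    rw [← hom_map_apply, ← Category.assoc, ← hom_map_apply, ← hom_map_apply]
    rfl

instance : (functor e).Additive where
  map_add {M N f g} := hom_ext e fun x => by
    change _ ≫ map e (f + g) = _ ≫ (map e f + map e g)
    rw [← hom_map_apply, Preadditive.comp_add, ← hom_map_apply, ← hom_map_apply,
      ← HomModule.hom_add, ← map_add]
    rfl

instance : (functor e).Faithful where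
  map_injective {M N f g} h := by
    refine ObjectProperty.hom_ext _ (ModuleCat.hom_ext (LinearMap.ext fun x => ?_))
    refine (equiv e N).injective (HomModule.ext ?_)
    rw [hom_map_apply, hom_map_apply]
    exact congrArg _ h

instance : (functor e).Full where
  map_surjective {M N} f := by
    refine ⟨ObjectProperty.homMk (ModuleCat.ofHom
      ((equiv e N).symm.toLinearMap ∘ₗ HomModule.map e f ∘ₗ (equiv e M).toLinearMap)),
      hom_ext e fun x => ?_⟩
    change _ ≫ map e _ = _
    rw [← hom_map_apply]
    exact congrArg HomModule.hom ((equiv e N).apply_symm_apply _)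

lemma exists_obj_iso {X : C} (r : RetractData T X) :
    ∃ M : FGProj Λ, Nonempty ((functor e).obj M ≅ X) := by
  have := r.finite_homModule (e := e)
  have := r.projective_homModule (e := e)
  -- Morphisms of `C` live in another universe than Λ; as a quotient of Λⁿ the module is
  -- nevertheless small enough to be moved to that of Λ.
  have : Small.{u} (HomModule e X) := small_of_surjective
    (LinearMap.surjective_of_comp_eq_id _ _ (r.ofCoord_comp_coord (e := e)))
  let i := Shrink.linearEquiv Λᵐᵒᵖ (HomModule e X)
  let M : FGProj Λ := ⟨ModuleCat.of Λᵐᵒᵖ (Shrink.{u} (HomModule e X)),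
    Module.Finite.equiv i.symm, Module.Projective.of_equiv i.symm⟩
  exact ⟨M, ⟨(retractData e M).isoOfEquiv r ((equiv e M).symm ≪≫ₗ i)⟩⟩

end Realization

/-! ### The Nakayama functor and the Serre functor -/

namespace HomModule

omit [HasFiniteBiproducts C] [IsIdempotentComplete C]

variable {M : Type u} [AddCommGroup M] [Module Λᵐᵒᵖ M]

variable {e} in
/-- Morphisms `X ⟶ T` correspond to linear forms on `M ≅ Hom(T, X)`. -/
noncomputable def homEquivDual {X : C} (r : RetractData T X) (θ : M ≃ₗ[Λᵐᵒᵖ] HomModule e X) :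
    (X ⟶ T) ≃ₗ[k] (M →ₗ[Λᵐᵒᵖ] Λ) where
  toFun g := (regular e).symm.toLinearMap ∘ₗ HomModule.map e g ∘ₗ θ.toLinearMap
  map_add' f g := LinearMap.ext fun x => by
    change e.symm ((θ x).hom ≫ (f + g)) = e.symm ((θ x).hom ≫ f) + e.symm ((θ x).hom ≫ g)
    rw [← map_add, Preadditive.comp_add]
  map_smul' c g := LinearMap.ext fun x => by
    change e.symm ((θ x).hom ≫ (c • g)) = c • e.symm ((θ x).hom ≫ g)
    rw [← map_smul, Linear.comp_smul]
  invFun ψ := r.lift e ((regular e).toLinearMap ∘ₗ ψ ∘ₗ θ.symm.toLinearMap)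
  left_inv g := r.map_injective (e := e) <| by
    rw [RetractData.map_lift]
    ext x
    simp
  right_inv ψ := by
    change (regular e).symm.toLinearMap ∘ₗ HomModule.map e (r.lift e _) ∘ₗ θ.toLinearMap = ψ
    rw [RetractData.map_lift]
    ext x
    simp

variable {e} {X : C} (r : RetractData T X) (θ : M ≃ₗ[Λᵐᵒᵖ] HomModule e X)

lemma homEquivDual_apply (g : X ⟶ T) (x : M) :
    homEquivDual r θ g x = e.symm ((θ x).hom ≫ g) := rfl

/-- Together with naturality of Serre duality in T, this gives the Λ-linearity of `nakayamaEquiv`.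
-/
lemma smul_homEquivDual (a : Λ) (g : X ⟶ T) :
    a • homEquivDual r θ g = homEquivDual r θ (g ≫ (e a : T ⟶ T)) := by
  refine LinearMap.ext fun x => e.injective ?_
  change e (a * e.symm ((θ x).hom ≫ g)) = e (e.symm ((θ x).hom ≫ g ≫ (e a : T ⟶ T)))
  rw [map_mul, e.apply_symm_apply, e.apply_symm_apply, Category.assoc]

/-- For a Serre functor `S`, the module `Hom(T, S X)` is `ν Hom(T, X)`. -/
noncomputable def nakayamaEquiv {S : C ⥤ C} (D : SerreDuality k S) :
    HomModule e (S.obj X) ≃ₗ[Λᵐᵒᵖ] NakayamaModule k Λ M where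
  toFun h := (D.equiv T X h.hom) ∘ₗ (homEquivDual r θ).symm.toLinearMap
  map_add' f g := by
    rw [hom_add, map_add]
    rfl
  map_smul' a h := by
    refine LinearMap.ext fun ψ => ?_
    obtain ⟨g, rfl⟩ := (homEquivDual r θ).surjective ψ
    change D.equiv T X ((e a.unop : T ⟶ T) ≫ h.hom) ((homEquivDual r θ).symm
      (homEquivDual r θ g)) = D.equiv T X h.hom ((homEquivDual r θ).symm
        (a.unop • homEquivDual r θ g))
    rw [smul_homEquivDual, LinearEquiv.symm_apply_apply, LinearEquiv.symm_apply_apply]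
    have := D.naturality (e a.unop : T ⟶ T) (𝟙 X) h.hom g
    simpa using this
  invFun φ := of e ((D.equiv T X).symm (φ ∘ₗ (homEquivDual r θ).toLinearMap))
  left_inv h := HomModule.ext <| by
    rw [hom_of, LinearEquiv.symm_apply_eq]
    refine LinearMap.ext fun g => ?_
    simp
  right_inv φ := by
    refine LinearMap.ext fun ψ => ?_
    refine (DFunLike.congr_fun ((D.equiv T X).apply_symm_apply _) _).trans ?_
    exact congrArg (show Module.Dual k (M →ₗ[Λᵐᵒᵖ] Λ) from φ) ((homEquivDual r θ).apply_symm_apply ψ)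

lemma nakayamaEquiv_apply {S : C ⥤ C} (D : SerreDuality k S) (h : HomModule e (S.obj X))
    (g : X ⟶ T) : (show Module.Dual k (M →ₗ[Λᵐᵒᵖ] Λ) from nakayamaEquiv r θ D h)
      (homEquivDual r θ g) = D.equiv T X h.hom g :=
  congrArg (D.equiv T X h.hom) ((homEquivDual r θ).symm_apply_apply g)

end HomModule

namespace Realization

variable {S : C ⥤ C} (D : SerreDuality k S)

/-- The isomorphism `Hom(T, S X) ≅ ν M` for `X` realizing `M`. -/
noncomputable def nakayamaEquiv (M : FGProj Λ) :
    HomModule e (S.obj (obj e M)) ≃ₗ[Λᵐᵒᵖ] (nakayama k Λ).obj M.obj :=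
  HomModule.nakayamaEquiv (retractData e M) (equiv e M) D

lemma nakayamaEquiv_naturality {M N : FGProj Λ} (f : M ⟶ N)
    (h : HomModule e (S.obj (obj e M))) :
    ((nakayama k Λ).map f.hom).hom (nakayamaEquiv e D M h) =
      nakayamaEquiv e D N (HomModule.map e (S.map (map e f)) h) := by
  refine LinearMap.ext fun ψ => ?_
  obtain ⟨g, rfl⟩ := (HomModule.homEquivDual (retractData e N) (equiv e N)).surjective ψ
  refine Eq.trans ?_ (HomModule.nakayamaEquiv_apply (retractData e N) (equiv e N) D _ g).symm
  have h₁ : HomModule.homEquivDual (retractData e N) (equiv e N) g ∘ₗ f.hom.hom =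
      HomModule.homEquivDual (retractData e M) (equiv e M) (map e f ≫ g) :=
    LinearMap.ext fun x => by
      rw [LinearMap.comp_apply, HomModule.homEquivDual_apply, HomModule.homEquivDual_apply,
        hom_map_apply, Category.assoc]
  refine (congrArg (show Module.Dual k (M.obj →ₗ[Λᵐᵒᵖ] Λ) from nakayamaEquiv e D M h) h₁).trans ?_
  refine (HomModule.nakayamaEquiv_apply (retractData e M) (equiv e M) D h _).trans ?_
  have := D.naturality (𝟙 T) (map e f) h.hom g
  simpa using this.symm

include D in
lemma fgProjective_nakayama {M : FGProj Λ} (r : RetractData T (S.obj (obj e M))) :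
    fgProjective Λ ((nakayama k Λ).obj M.obj) :=
  have := r.finite_homModule (e := e)
  have := r.projective_homModule (e := e)
  ⟨Module.Finite.equiv (nakayamaEquiv e D M), Module.Projective.of_equiv (nakayamaEquiv e D M)⟩

section

variable (h : ∀ P : FGProj Λ, fgProjective Λ ((nakayama k Λ).obj P.obj))
  (r : ∀ M : FGProj Λ, RetractData T (S.obj (obj e M)))

/-- The isomorphism `Hom(T, Y) ≅ Hom(T, S X)` for `X` realizing `M` and `Y` realizing `ν M`. -/
noncomputable def nakayamaHomEquiv (M : FGProj Λ) :
    HomModule e (obj e ((nakayamaProj k Λ h).obj M)) ≃ₗ[Λᵐᵒᵖ] HomModule e (S.obj (obj e M)) :=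
  (equiv e ((nakayamaProj k Λ h).obj M)).symm ≪≫ₗ (nakayamaEquiv e D M).symm

lemma nakayamaHomEquiv_symm_apply (M : FGProj Λ) (t : HomModule e (S.obj (obj e M))) :
    (nakayamaHomEquiv e D h M).symm t =
      equiv e ((nakayamaProj k Λ h).obj M) (nakayamaEquiv e D M t) := rfl

lemma nakayamaHomEquiv_symm_naturality {M N : FGProj Λ} (f : M ⟶ N)
    (t : HomModule e (S.obj (obj e M))) :
    HomModule.map e (map e ((nakayamaProj k Λ h).map f)) ((nakayamaHomEquiv e D h M).symm t) =
      (nakayamaHomEquiv e D h N).symm (HomModule.map e (S.map (map e f)) t) := by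
  rw [nakayamaHomEquiv_symm_apply, nakayamaHomEquiv_symm_apply]
  refine (map_map_apply e ((nakayamaProj k Λ h).map f) _).trans ?_
  exact congrArg (equiv e ((nakayamaProj k Λ h).obj N)) (nakayamaEquiv_naturality e D f t)

/-- The Nakayama functor on `proj Λ` corresponds to the Serre functor on `add T`. -/
noncomputable def nakayamaIso : nakayamaProj k Λ h ⋙ functor e ≅ functor e ⋙ S :=
  NatIso.ofComponents
    (fun M => (retractData e ((nakayamaProj k Λ h).obj M)).isoOfEquiv (r M)
      (nakayamaHomEquiv e D h M))
    (fun {M N} f => by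
      refine (retractData e ((nakayamaProj k Λ h).obj M)).map_injective (e := e) ?_
      change HomModule.map e (map e ((nakayamaProj k Λ h).map f) ≫
          (retractData e ((nakayamaProj k Λ h).obj N)).lift e
            (nakayamaHomEquiv e D h N).toLinearMap) =
        HomModule.map e ((retractData e ((nakayamaProj k Λ h).obj M)).lift e
          (nakayamaHomEquiv e D h M).toLinearMap ≫ S.map (map e f))
      rw [HomModule.map_comp, HomModule.map_comp, RetractData.map_lift, RetractData.map_lift]
      refine LinearMap.ext fun t => ?_
      obtain ⟨t, rfl⟩ := (nakayamaHomEquiv e D h M).symm.surjective t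
      simp only [LinearMap.comp_apply, LinearEquiv.coe_coe, LinearEquiv.apply_symm_apply,
        nakayamaHomEquiv_symm_naturality])

end

end Realization

end Realization

/-- An endofunctor which corresponds to an equivalence under a fully faithful functor is an
equivalence if the equivalence reflects membership in the essential image. -/
lemma isEquivalence_of_comp_iso {F : Type*} [Category* F] {C : Type*} [Category* C] {N : F ⥤ F}
    {G : F ⥤ C} {S : C ⥤ C} [G.Full] [G.Faithful] [S.IsEquivalence] (τ : N ⋙ G ≅ G ⋙ S)
    (h : ∀ Q : F, ∃ M : F, Nonempty (S.obj (G.obj M) ≅ G.obj Q)) : N.IsEquivalence where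
  faithful := Functor.Faithful.of_comp_iso τ
  full := Functor.Full.of_comp_faithful_iso τ
  essSurj := ⟨fun Q => by
    obtain ⟨M, ⟨i⟩⟩ := h Q
    exact ⟨M, ⟨G.preimageIso (τ.app M ≪≫ i)⟩⟩⟩

/-! ### The 4-angulation of proj Λ -/

theorem mainTheorem5
    {k : Type u} [Field k]
    {C : Type w} [Category.{v} C] [Preadditive C] [Linear k C] [HasZeroObject C] [HasShift C ℤ]
    [∀ n : ℤ, (shiftFunctor C n).Additive] [∀ n : ℤ, (shiftFunctor C n).Linear k]
    [Pretriangulated C] [IsTriangulated C] [IsIdempotentComplete C]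
    (hfin : ∀ X Y : C, Module.Finite k (X ⟶ Y))
    (hCY : IsWeaklyCalabiYau k C 2)
    (T : C) (hT : IsClusterTilting 2 (addProperty T))
    (Λ : Type u) [Ring Λ] [Algebra k Λ] (e : Λ ≃ₐ[k] End T)
    (hΛ : IsSelfinjective Λ) :
    ∃ (h : ∀ P : FGProj Λ, fgProjective Λ ((nakayama k Λ).obj P.obj))
      (_ : (nakayamaProj k Λ h).IsEquivalence),
      ∃ A : Set (FourSeq (nakayamaProj k Λ h)), IsFourAngulation (nakayamaProj k Λ h) A := by
  obtain ⟨D⟩ := hCY.exists_serreDuality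
  obtain ⟨ρ⟩ := exists_retractData_serre e hfin D hT hΛ
  have hS : ∀ X, addProperty T X → addProperty T (X⟦(1 : ℤ)⟧⟦(1 : ℤ)⟧) :=
    fun _ => hT.addProperty_shift_shift ρ
  have hG : ∀ M : FGProj Λ, addProperty T (Realization.obj e M) :=
    fun M => (Realization.retractData e M).addProperty hT
  have hG' : ∀ X, addProperty T X → ∃ M, Nonempty ((Realization.functor e).obj M ≅ X) := by
    intro X hX
    obtain ⟨r⟩ := hX.exists_retractData
    exact Realization.exists_obj_iso e r
  let r : ∀ M : FGProj Λ, RetractData T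
      ((shiftFunctor C (1 : ℤ) ⋙ shiftFunctor C (1 : ℤ)).obj (Realization.obj e M)) :=
    fun M => (hS _ (hG M)).exists_retractData.some
  let h : ∀ P : FGProj Λ, fgProjective Λ ((nakayama k Λ).obj P.obj) :=
    fun M => Realization.fgProjective_nakayama e D (r M)
  let τ : nakayamaProj k Λ h ⋙ Realization.functor e ≅
      Realization.functor e ⋙ shiftFunctor C (1 : ℤ) ⋙ shiftFunctor C (1 : ℤ) :=
    Realization.nakayamaIso e D h r
  have : (nakayamaProj k Λ h).IsEquivalence := isEquivalence_of_comp_iso τ fun Q => by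
    let E := (shiftFunctor C (1 : ℤ) ⋙ shiftFunctor C (1 : ℤ))
    let i := E.objObjPreimageIso (Realization.obj e Q)
    -- Essential surjectivity of ν: Σ² reflects membership in add T, so the Σ²-preimage of an object
    -- of add T is again realized by a projective module.
    obtain ⟨M, ⟨j⟩⟩ := hG' (E.objPreimage (Realization.obj e Q))
      (hT.of_addProperty_shift_shift hS (hT.of_iso i.symm (hG Q)))
    exact ⟨M, ⟨E.mapIso j ≪≫ i⟩⟩
  exact ⟨h, this, standardFourAngles τ, isFourAngulation_standardFourAngles (addProperty T) hG hG'
    hT.functoriallyFinite.2 hT.iff_left fun _ _ => hT.shift_hom_eq_zero hS⟩
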